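/- **Theorem.** Let $(X,m)$ be a locally compact metric space, let $C_0(X)$ be the C*-algebra of complex valued continuous functions on $X$ vanishing at infinity, and let $$\mathsf{Lip}_m(f)=\sup\left\{\frac{|f(y)-f(x)|}{m(y,x)} : x,y\in X,\ x\neq y\right\}\in[0,\infty].$$ Then the triple $(C_0(X),\mathsf{Lip}_m,C_0(X))$ is a quantum locally compact metric space. Here the following definitions are used. For a C*-algebra $A$, $\mathfrak{u}A$ is the smallest unital C*-algebra containing $A$ ($A$ itself if $A$ is unital, the unitization $A\oplus\mathbb{C}$ otherwise), $\mathfrak{sa}(\cdot)$ denotes the self-adjoint part, and $\mathscr{S}(A)$ is the state space of $A$, each state being extended to $\mathfrak{u}A$ by $\varphi(1)=1$ and to a normal state of the enveloping von Neumann algebra $A^{**}$. * A *Lipschitz triple* $(A,L,M)$ consists of a C*-algebra $A$, a seminorm $L$ defined on a dense subspace of $\mathfrak{sa}(\mathfrak{u}A)$ (with $L=\infty$ off this subspace) with $\{a\in\mathfrak{sa}(\mathfrak{u}A):L(a)=0\}=\mathbb{R}1$, and an Abelian C*-subalgebra $M$ of $A$ that contains an approximate identity of $A$. A seminorm given on $\mathfrak{sa}(A)$,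 such as $\mathsf{Lip}_m$ on $\mathfrak{sa}(C_0(X))$, is extended to $\mathfrak{sa}(\mathfrak{u}A)$ by $L(a+t1)=L(a)$, $t\in\mathbb{R}$. * The *extended Monge–Kantorovich metric* is $\mathsf{mk}_L(\varphi,\psi)=\sup\{|\varphi(a)-\psi(a)| : a\in\mathfrak{sa}(A),\ L(a)\le 1\}$ for $\varphi,\psi\in\mathscr{S}(A)$. * For a compact subset $K$ of the Gel'fand spectrum $\sigma(M)$, let $\chi_K\in M^{**}\subseteq A^{**}$ be its indicator function and $\mathscr{S}(A|K)=\{\varphi\in\mathscr{S}(A):\varphi(\chi_K)=1\}$. A *local state* is an element of $\bigcup_K\mathscr{S}(A|K)$. * The triple is *regular* if, for every compact $K\subseteq\sigma(M)$, the set $\mathscr{S}(A|K)$ has finite diameter for $\mathsf{mk}_L$. * A set $\mathscr{K}\subseteq\mathscr{S}(A)$ is *tame* if, for some local state $\mu$, $$\lim_{K}\ \sup\{|\varphi(a-\chi_K a\chi_K)| : \varphi\in\mathscr{K},\ a\in\mathfrak{sa}(\mathfrak{u}A),\ L(a)\le1,\ \mu(a)=0\}=0,$$ the limit being taken along the compact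 subsets $K$ of $\sigma(M)$ directed by inclusion. * $(A,L,M)$ is a *quantum locally compact metric space* if it is a regular Lipschitz triple and, for every tame $\mathscr{K}\subseteq\mathscr{S}(A)$, the topology that $\mathsf{mk}_L$ induces on $\mathscr{K}$ is the restriction to $\mathscr{K}$ of the weak* topology $\sigma(A^*,A)$. -/

import Mathlib

open scoped ComplexOrder ENNReal Topology ZeroAtInfty InnerProductSpace MultiplierAlgebra

noncomputable section

namespace QMetric

universe u

/-! ### Hilbert sums of representations -/

section HilbertSum

variable {ι : Type*} {E : ι → Type*} [∀ i, NormedAddCommGroup (E i)]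
  [∀ i, InnerProductSpace ℂ (E i)]

/-- The operator `(v i) ↦ (T i (v i))` on a Hilbert sum, for a bounded family of operators. -/
def hilbertSumOp (T : ∀ i, E i →L[ℂ] E i) (C : ℝ) (hT : ∀ i, ‖T i‖ ≤ C) :
    lp E 2 →L[ℂ] lp E 2 :=
  have hC (v : lp E 2) (i : ι) : ‖T i (v i)‖ ≤ ‖((C : ℂ) • v) i‖ := by
    have h0 : 0 ≤ C := (norm_nonneg _).trans (hT i)
    rw [lp.coeFn_smul, Pi.smul_apply, norm_smul, Complex.norm_real, Real.norm_of_nonneg h0]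
    exact ((T i).le_opNorm _).trans (mul_le_mul_of_nonneg_right (hT i) (norm_nonneg _))
  LinearMap.mkContinuous
    { toFun := fun v => ⟨fun i => T i (v i), (lp.memℓp ((C : ℂ) • v)).mono' (hC v)⟩
      map_add' := fun v w => by ext i : 2; exact map_add (T i) _ _
      map_smul' := fun c v => by ext i : 2; exact map_smul (T i) _ _ }
    ‖(C : ℂ)‖ (fun v => by
      rw [← norm_smul]
      exact lp.norm_mono (by norm_num) (hC v))

lemma hilbertSumOp_apply (T : ∀ i, E i →L[ℂ] E i) (C : ℝ) (hT : ∀ i, ‖T i‖ ≤ C)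
    (v : lp E 2) (i : ι) : hilbertSumOp T C hT v i = T i (v i) := rfl

variable [∀ i, CompleteSpace (E i)]

/-- The Hilbert sum of a family of representations of a unital C*-algebra. -/
def hilbertSumRep {B : Type*} [CStarAlgebra B] (π : ∀ i, B →⋆ₐ[ℂ] (E i →L[ℂ] E i)) :
    B →⋆ₐ[ℂ] (lp E 2 →L[ℂ] lp E 2) where
  toFun b := hilbertSumOp (fun i => π i b) ‖b‖ (fun i => NonUnitalStarAlgHom.norm_apply_le (π i) b)
  map_one' := by ext v i : 3; simp only [hilbertSumOp_apply, map_one]; rfl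
  map_mul' a b := by ext v i : 3; simp only [hilbertSumOp_apply, map_mul]; rfl
  map_zero' := by ext v i : 3; simp only [hilbertSumOp_apply, map_zero]; rfl
  map_add' a b := by ext v i : 3; simp only [hilbertSumOp_apply, map_add]; rfl
  commutes' c := by ext v i : 3; simp only [hilbertSumOp_apply, AlgHomClass.commutes]; rfl
  map_star' b := by
    refine (ContinuousLinearMap.eq_adjoint_iff _ _).2 fun v w => ?_
    simp only [lp.inner_eq_tsum, hilbertSumOp_apply, map_star]
    exact tsum_congr fun i => ContinuousLinearMap.adjoint_inner_left _ _ _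

lemma hilbertSumRep_apply {B : Type*} [CStarAlgebra B] (π : ∀ i, B →⋆ₐ[ℂ] (E i →L[ℂ] E i))
    (b : B) (v : lp E 2) (i : ι) : hilbertSumRep π b v i = π i b (v i) := rfl

end HilbertSum

section General

variable (A : Type u) [NonUnitalCStarAlgebra A]

/-! ### The smallest unital C*-algebra containing `A` -/

/-- The smallest unital C*-algebra `𝔲A` containing the C*-algebra `A`: the C*-subalgebra `A + ℂ 1`
of the multiplier algebra of `A`.  It is `A` itself if `A` is unital (the multiplier algebra of a
unital C*-algebra `A` is `A`), and the standard unitization `A ⊕ ℂ` otherwise. -/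
def smallestUnitization : StarSubalgebra ℂ 𝓜(ℂ, A) :=
  (Unitization.starLift (DoubleCentralizer.coeHom (𝕜 := ℂ) (A := A))).range

variable {A}

lemma mem_smallestUnitization {x : 𝓜(ℂ, A)} :
    x ∈ smallestUnitization A ↔
      ∃ (a : A) (c : ℂ), x = DoubleCentralizer.coeHom (𝕜 := ℂ) a + algebraMap ℂ _ c := by
  constructor
  · rintro ⟨y, rfl⟩
    refine ⟨y.snd, y.fst, ?_⟩
    simp [Unitization.starLift, add_comm]
  · rintro ⟨a, c, rfl⟩
    refine ⟨Unitization.inl c + (a : Unitization ℂ A), ?_⟩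
    simp [Unitization.starLift, add_comm]

lemma norm_coeHom (a : A) : ‖DoubleCentralizer.coeHom (𝕜 := ℂ) a‖ = ‖a‖ := by
  rw [← DoubleCentralizer.norm_fst]
  exact ContinuousLinearMap.opNorm_mul_apply ℂ A a

instance isClosed_smallestUnitization :
    IsClosed (smallestUnitization A : Set 𝓜(ℂ, A)) := by
  let f : A →ₗ[ℂ] 𝓜(ℂ, A) :=
    { toFun := DoubleCentralizer.coeHom (𝕜 := ℂ)
      map_add' := map_add _
      map_smul' := map_smul _ }
  have hf : Isometry f := AddMonoidHomClass.isometry_of_norm f norm_coeHom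
  have h1 : IsClosed ((LinearMap.range f : Submodule ℂ 𝓜(ℂ, A)) : Set 𝓜(ℂ, A)) := by
    rw [LinearMap.coe_range]
    exact hf.isClosedEmbedding.isClosed_range
  have h2 := Submodule.isClosed_sup_finiteDimensional _ (Submodule.span ℂ {(1 : 𝓜(ℂ, A))}) h1
  convert h2
  ext x
  rw [SetLike.mem_coe, mem_smallestUnitization, SetLike.mem_coe, Submodule.mem_sup]
  constructor
  · rintro ⟨a, c, rfl⟩
    exact ⟨_, ⟨a, rfl⟩, _, Submodule.mem_span_singleton.2 ⟨c, rfl⟩, by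
      rw [Algebra.algebraMap_eq_smul_one]; rfl⟩
  · rintro ⟨_, ⟨a, rfl⟩, _, h, rfl⟩
    obtain ⟨c, rfl⟩ := Submodule.mem_span_singleton.1 h
    exact ⟨a, c, by rw [Algebra.algebraMap_eq_smul_one]; rfl⟩

variable (A) in
/-- `𝔲A` as a type; it is a unital C*-algebra. -/
def UA : Type u := smallestUnitization A

instance : CStarAlgebra (UA A) := inferInstanceAs (CStarAlgebra (smallestUnitization A))

/-- `𝔲A` carries the usual order of a C*-algebra. -/
instance : PartialOrder (UA A) := CStarAlgebra.spectralOrder (UA A)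

instance : StarOrderedRing (UA A) := CStarAlgebra.spectralOrderedRing (UA A)

/-- The inclusion of `A` in `𝔲A`. -/
def incl : A →⋆ₙₐ[ℂ] UA A where
  toFun a := ⟨DoubleCentralizer.coeHom (𝕜 := ℂ) a, mem_smallestUnitization.2 ⟨a, 0, by simp⟩⟩
  map_smul' _ _ := Subtype.ext (map_smul _ _ _)
  map_zero' := Subtype.ext (map_zero _)
  map_add' _ _ := Subtype.ext (map_add _ _ _)
  map_mul' _ _ := Subtype.ext (map_mul _ _ _)
  map_star' _ := Subtype.ext (map_star _ _)

/-! ### States -/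

variable (A) in
/-- The state space of `A`.  Every state of `A` has a unique extension to a state of `𝔲A`, and is
identified with it: a state of `A` is a state of `𝔲A` whose restriction to `A` has norm `1`. -/
def StateSpace : Type u :=
  {φ : UA A →ₚ[ℂ] ℂ // φ 1 = 1 ∧ IsLUB ((fun a : A => ‖φ (incl a)‖) '' Metric.closedBall 0 1) 1}

/-- The value of a state at an element of `𝔲A`. -/
def StateSpace.eval (φ : StateSpace A) (a : UA A) : ℂ := φ.1 a

variable (A) in
/-- The weak* topology `σ(A*, A)` on the state space of `A`. -/
@[reducible] def weakStar : TopologicalSpace (StateSpace A) :=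
  TopologicalSpace.induced (fun (φ : StateSpace A) (a : A) => φ.eval (incl a)) inferInstance

/-! ### The universal representation and the enveloping von Neumann algebra -/

variable (A) in
/-- The Hilbert space of the universal representation of `A`: the Hilbert sum of the
Gelfand–Naimark–Segal spaces of all the states of `A`. -/
def UniversalSpace : Type u := lp (fun φ : StateSpace A => φ.1.GNS) 2

instance : NormedAddCommGroup (UniversalSpace A) :=
  inferInstanceAs (NormedAddCommGroup (lp (fun φ : StateSpace A => φ.1.GNS) 2))

instance : InnerProductSpace ℂ (UniversalSpace A) :=
  inferInstanceAs (InnerProductSpace ℂ (lp (fun φ : StateSpace A => φ.1.GNS) 2))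

instance : CompleteSpace (UniversalSpace A) :=
  inferInstanceAs (CompleteSpace (lp (fun φ : StateSpace A => φ.1.GNS) 2))

/-- The universal representation of `A` (extended to `𝔲A`): the Hilbert sum of the
Gelfand–Naimark–Segal representations of all the states of `A`. -/
def universalRep : UA A →⋆ₐ[ℂ] (UniversalSpace A →L[ℂ] UniversalSpace A) :=
  hilbertSumRep fun φ : StateSpace A => φ.1.gnsStarAlgHom

variable (A) in
/-- The enveloping von Neumann algebra `A**` of `A`: the double commutant of the image of `A` in
the universal representation. -/
def envelopingVonNeumannAlgebra : Set (UniversalSpace A →L[ℂ] UniversalSpace A) :=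
  Set.centralizer (Set.centralizer (Set.range fun a : A => universalRep (incl a)))

/-- The vector of the universal Hilbert space which implements the state `φ`: the canonical cyclic
vector of the Gelfand–Naimark–Segal space of `φ`, placed in the summand of `φ`. -/
def stateVector (φ : StateSpace A) : UniversalSpace A := by
  classical
  exact lp.single 2 φ ((φ.1.toPreGNS 1 : φ.1.PreGNS) : φ.1.GNS)

/-- The unique normal extension of the state `φ` to the enveloping von Neumann algebra of `A`. -/
def StateSpace.normalExtension (φ : StateSpace A)
    (T : UniversalSpace A →L[ℂ] UniversalSpace A) : ℂ :=
  ⟪stateVector φ, T (stateVector φ)⟫_ℂ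

lemma StateSpace.normalExtension_universalRep (φ : StateSpace A) (a : UA A) :
    φ.normalExtension (universalRep a) = φ.eval a := by
  classical
  change ⟪lp.single (E := fun φ : StateSpace A => φ.1.GNS) 2 φ _,
    hilbertSumRep (fun φ : StateSpace A => φ.1.gnsStarAlgHom) a (lp.single 2 φ _)⟫_ℂ = _
  rw [lp.inner_single_left, hilbertSumRep_apply, lp.single_apply_self]
  simp [PositiveLinearMap.preGNS_inner_def, StateSpace.eval]

/-! ### Indicator functions of compact subsets of the spectrum -/

/-- The Gel'fand spectrum of a C*-subalgebra `M` of `A`, with its weak* topology. -/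
abbrev Spec (M : NonUnitalStarSubalgebra ℂ A) : Type u := WeakDual.characterSpace ℂ M

/-- The set of the vectors of the universal Hilbert space that are annihilated by every element
of `M` whose Gel'fand transform vanishes on `K`. -/
def supportedOn (M : NonUnitalStarSubalgebra ℂ A) (K : TopologicalSpace.Compacts (Spec M)) :
    Submodule ℂ (UniversalSpace A) :=
  ⨅ f ∈ {f : M | ∀ χ ∈ K, χ f = 0},
    (universalRep (incl (f : A)) : UniversalSpace A →L[ℂ] UniversalSpace A).ker

lemma mem_supportedOn {M : NonUnitalStarSubalgebra ℂ A} {K : TopologicalSpace.Compacts (Spec M)}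
    {v : UniversalSpace A} :
    v ∈ supportedOn M K ↔ ∀ f : M, (∀ χ ∈ K, χ f = 0) → universalRep (incl (f : A)) v = 0 := by
  simp [supportedOn]

instance (M : NonUnitalStarSubalgebra ℂ A) (K : TopologicalSpace.Compacts (Spec M)) :
    CompleteSpace (supportedOn M K) := by
  have h : IsClosed (supportedOn M K : Set (UniversalSpace A)) := by
    simp only [supportedOn, Submodule.coe_iInf]
    exact isClosed_biInter fun f _ => (universalRep (incl (f : A))).isClosed_ker
  exact h.completeSpace_coe

/-- The indicator function `χ_K ∈ M** ⊆ A**` of a compact subset `K` of the spectrum of `M`.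
The indicator function `1 - χ_K` of the complement of `K` is the supremum of an increasing
approximate unit of the ideal of the `f ∈ M` that vanish on `K`, that is, the projection onto the
closed span of the vectors `f v` for such `f`.  So `χ_K` is the orthogonal projection onto the
vectors annihilated by all such `f` (as `M` acts nondegenerately if it contains an approximate
identity of `A`). -/
def indicator (M : NonUnitalStarSubalgebra ℂ A) (K : TopologicalSpace.Compacts (Spec M)) :
    UniversalSpace A →L[ℂ] UniversalSpace A :=
  (supportedOn M K).starProjection

/-- `χ_K` lies in the von Neumann algebra generated by `M`. -/
lemma indicator_mem_doubleCommutant (M : NonUnitalStarSubalgebra ℂ A)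
    (K : TopologicalSpace.Compacts (Spec M)) :
    indicator M K ∈
      Set.centralizer (Set.centralizer (Set.range fun f : M => universalRep (incl (f : A)))) := by
  intro B hB
  have hB1 : ∀ v ∈ supportedOn M K, B v ∈ supportedOn M K := by
    intro v hv
    rw [mem_supportedOn] at hv ⊢
    intro f hf
    have h := congrArg (fun T => T v) (hB _ ⟨f, rfl⟩)
    simp only [mul_apply_eq_comp] at h
    rw [h, hv f hf, map_zero]
  have hB2 : ∀ v ∈ supportedOn M K, star B v ∈ supportedOn M K := by
    intro v hv
    rw [mem_supportedOn] at hv ⊢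
    intro f hf
    have h := congrArg (fun T => (star T) v) (hB _ ⟨star f, rfl⟩)
    have hs : star (universalRep (incl ((star f : M) : A))) = universalRep (incl (f : A)) := by
      change star (universalRep (incl (star (f : A)))) = _
      rw [map_star, map_star, star_star]
    simp only [star_mul, hs, mul_apply_eq_comp] at h
    rw [← h, hv f hf, map_zero]
  ext v : 1
  change B ((supportedOn M K).starProjection v) = (supportedOn M K).starProjection (B v)
  refine (Submodule.eq_starProjection_of_mem_of_inner_eq_zero
    (hB1 _ (Submodule.starProjection_apply_mem _ _)) fun w hw => ?_).symm
  rw [← map_sub, ← ContinuousLinearMap.adjoint_inner_right]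
  exact Submodule.starProjection_inner_eq_zero _ _ (hB2 w hw)

lemma indicator_mem_envelopingVonNeumannAlgebra (M : NonUnitalStarSubalgebra ℂ A)
    (K : TopologicalSpace.Compacts (Spec M)) : indicator M K ∈ envelopingVonNeumannAlgebra A := by
  refine Set.centralizer_subset (Set.centralizer_subset ?_) (indicator_mem_doubleCommutant M K)
  rintro _ ⟨f, rfl⟩
  exact ⟨f, rfl⟩

/-! ### Lipschitz pairs and the extended Monge-Kantorovich metric -/

/-- Lipschitz pairs `(A, L)`.  A seminorm defined on a subspace of the self-adjoint part of `𝔲A`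
is a function with values in `[0, ∞]`, its domain being the set of the self-adjoint elements at
which it is finite.  Only the values of `L` at self-adjoint elements are relevant. -/
structure IsLipschitzPair (L : UA A → ℝ≥0∞) : Prop where
  add_le : ∀ a b : UA A, IsSelfAdjoint a → IsSelfAdjoint b → L (a + b) ≤ L a + L b
  smul : ∀ (t : ℝ) (a : UA A), IsSelfAdjoint a → L (t • a) = ‖t‖ₑ * L a
  dense : ∀ a : UA A, IsSelfAdjoint a → a ∈ closure {b : UA A | IsSelfAdjoint b ∧ L b < ∞}
  eq_zero_iff : ∀ a : UA A, IsSelfAdjoint a → (L a = 0 ↔ ∃ t : ℝ, a = t • (1 : UA A))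

/-- The extension `a + t 1 ↦ L a` (for `a ∈ A` self-adjoint and `t ∈ ℝ`) to `𝔲A` of a function `L`
on the self-adjoint part of `A`.  The decomposition `a + t 1` is unique if `A` is not unital; if
`A` is unital, the extension agrees with `L` as soon as `L` is invariant under the translation by
the multiples of the unit. -/
def unitalExtension (L : A → ℝ≥0∞) (u : UA A) : ℝ≥0∞ :=
  ⨅ (a : A) (t : ℝ) (_ : IsSelfAdjoint a) (_ : u = incl a + t • (1 : UA A)), L a

/-- The extended Monge-Kantorovich metric on the state space. -/
@[reducible] def mongeKantorovich (L : UA A → ℝ≥0∞) : PseudoEMetricSpace (StateSpace A) where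
  edist φ ψ := ⨆ (a : A) (_ : IsSelfAdjoint a) (_ : L (incl a) ≤ 1),
    edist (φ.eval (incl a)) (ψ.eval (incl a))
  edist_self φ := by simp
  edist_comm φ ψ := by simp only [edist_comm]
  edist_triangle φ ψ ω := by
    refine iSup_le fun a => iSup_le fun ha => iSup_le fun h => ?_
    refine (edist_triangle _ (ψ.eval (incl a)) _).trans (add_le_add ?_ ?_)
    · exact le_iSup_of_le a (le_iSup_of_le ha (le_iSup_of_le h le_rfl))
    · exact le_iSup_of_le a (le_iSup_of_le ha (le_iSup_of_le h le_rfl))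

/-- The set `𝔏₁(A, L, μ)` of the self-adjoint `a ∈ 𝔲A` with `L a ≤ 1` and `μ a = 0`. -/
def lipschitzBall (L : UA A → ℝ≥0∞) (μ : StateSpace A) : Set (UA A) :=
  {a | IsSelfAdjoint a ∧ L a ≤ 1 ∧ μ.eval a = 0}

/-! ### Topographies and local states -/

/-- `(A, M)` is a topographic quantum space: `M` is an Abelian C*-subalgebra of `A` that contains
an approximate identity of `A` (consisting of positive elements of norm at most `1`). -/
structure IsTopography (M : NonUnitalStarSubalgebra ℂ A) : Prop where
  isClosed : IsClosed (M : Set A)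
  comm : ∀ a ∈ M, ∀ b ∈ M, a * b = b * a
  approximateUnit : letI := CStarAlgebra.spectralOrder A
    ∃ l : Filter A, l.IsIncreasingApproximateUnit ∧ (M : Set A) ∈ l

/-- The states of `A` supported on a compact subset `K` of the spectrum of `M`. -/
def localStates (M : NonUnitalStarSubalgebra ℂ A) (K : TopologicalSpace.Compacts (Spec M)) :
    Set (StateSpace A) :=
  {φ | φ.normalExtension (indicator M K) = 1}

/-- The local state space `𝒮(A|M)`. -/
def localStateSpace (M : NonUnitalStarSubalgebra ℂ A) : Set (StateSpace A) :=
  ⋃ K : TopologicalSpace.Compacts (Spec M), localStates M K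

/-! ### Lipschitz triples and quantum locally compact metric spaces -/

/-- Lipschitz triples `(A, L, M)`. -/
structure IsLipschitzTriple (L : UA A → ℝ≥0∞) (M : NonUnitalStarSubalgebra ℂ A) : Prop where
  isLipschitzPair : IsLipschitzPair L
  isTopography : IsTopography M

/-- Tame sets of states.  The limit is along the compact subsets `K` of the spectrum of `M`,
directed by inclusion, of the supremum of `|φ (a - χ_K a χ_K)|`. -/
def IsTame (L : UA A → ℝ≥0∞) (M : NonUnitalStarSubalgebra ℂ A) (𝒦 : Set (StateSpace A)) : Prop :=
  ∃ μ ∈ localStateSpace M,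
    Filter.Tendsto (fun K : TopologicalSpace.Compacts (Spec M) =>
        ⨆ (a : UA A) (_ : a ∈ lipschitzBall L μ) (φ : StateSpace A) (_ : φ ∈ 𝒦),
          ‖φ.normalExtension (universalRep a - indicator M K * universalRep a * indicator M K)‖ₑ)
      Filter.atTop (𝓝 0)

/-- Regular Lipschitz triples: the states supported on a compact subset of the spectrum form
a set of finite diameter for the extended Monge-Kantorovich metric. -/
structure IsRegularLipschitzTriple (L : UA A → ℝ≥0∞) (M : NonUnitalStarSubalgebra ℂ A) : Prop
    extends IsLipschitzTriple L M where
  regular : ∀ K : TopologicalSpace.Compacts (Spec M),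
    letI := mongeKantorovich L
    Metric.ediam (localStates M K) < ∞

/-- Quantum locally compact metric spaces `(A, L, M)`: regular Lipschitz triples such that on every
tame set of states, the topology of the extended Monge-Kantorovich metric is the restriction of the
weak* topology. -/
structure IsQuantumLocallyCompactMetricSpace (L : UA A → ℝ≥0∞)
    (M : NonUnitalStarSubalgebra ℂ A) : Prop extends IsRegularLipschitzTriple L M where
  topology_eq : ∀ 𝒦 : Set (StateSpace A), IsTame L M 𝒦 →
    TopologicalSpace.induced (Subtype.val : 𝒦 → StateSpace A)
        (mongeKantorovich L).toUniformSpace.toTopologicalSpace =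
      TopologicalSpace.induced (Subtype.val : 𝒦 → StateSpace A) (weakStar A)

end General

/-! ### The classical case -/

/-- The Lipschitz seminorm `Lip_m` on the complex valued continuous functions vanishing at
infinity on a metric space, with values in `[0, ∞]`. -/
def lipSeminorm {X : Type u} [MetricSpace X] (f : C₀(X, ℂ)) : ℝ≥0∞ :=
  ⨆ (x : X) (y : X) (_ : x ≠ y), edist (f y) (f x) / edist y x

end QMetric

end

/-! A state of `C₀(X)` behaves like a probability measure, and an element of `𝔲 C₀(X)` like a
function on `X` (`ext_ev`, `nonneg_of_ev`); for self-adjoint elements the extended seminorm is the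
Lipschitz constant of that function (`unitalExtension_eq`). Every character of `C₀(X)` is a point
evaluation, so a compact `K` in the spectrum amounts to the compact set `pointSet K` in `X`. By
commutativity `χ_K` commutes with the whole universal representation. Hence `φ (a - χ_K a χ_K)` is
the value at `a` of a positive functional, the part of `φ` outside `K`
(`normalExtension_sub_indicator`), and a state local to `K` sees only values on `pointSet K`.

Regularity follows: if `φ` is local to `K` and `L u ≤ 1`, then `φ u` differs from the value of `u`
at any point of `pointSet K` by at most the diameter. The Monge-Kantorovich topology is always finer
than weak*, because Lipschitz functions are dense among the self-adjoint elements.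

The converse on tame sets is the heart. Tameness bounds the integral of `u` outside `K`, while a
cutoff argument needs the integral of `|u|`. The Lipschitz ball contains two further test elements:
`r (e - 1)`, with `e` a bump equal to `1` on the support of `μ`, which bounds the mass outside `K`,
and `|u| - μ(|u|)`, which then bounds the integral of `|u|` there
(`exists_vectorFunctional_outerVector_abs_le`). So `u` may be replaced by `e u` with `e` compactly
supported, and by Arzelà–Ascoli finitely many functions `e w` control all the `e u` uniformly.
Finitely many elements of `C₀(X)` define a weak* neighbourhood. -/

noncomputable section

namespace QMetric

universe u

/-! ### Bump functions on locally compact metric spaces -/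

section Bump

variable {X : Type u} [MetricSpace X]

/-- A continuous compactly supported real function, as a complex function vanishing at infinity. -/
def ofRealCompactSupport (f : X → ℝ) (hf : Continuous f) {K : Set X} (hK : IsCompact K)
    (h0 : ∀ x ∉ K, f x = 0) : C₀(X, ℂ) where
  toFun x := (f x : ℂ)
  continuous_toFun := Complex.continuous_ofReal.comp hf
  zero_at_infty' := by
    refine tendsto_const_nhds.congr' ?_
    filter_upwards [hK.compl_mem_cocompact] with x hx
    rw [h0 x hx, Complex.ofReal_zero]

/-- The bump is `max 0 (1 - d(x, K) / r)`, with `r` so small that the `r`-thickening of `K` stays in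
a compact neighbourhood. The explicit Lipschitz constant `1 / r` is what later bounds the mass of
tame states outside a compact set. -/
lemma exists_lipschitz_bump [LocallyCompactSpace X] {K : Set X} (hK : IsCompact K) :
    ∃ r > 0, ∃ K₁ : Set X, IsCompact K₁ ∧ ∃ (f : X → ℝ) (e : C₀(X, ℂ)), (∀ x, e x = (f x : ℂ)) ∧
      (∀ x, 0 ≤ f x) ∧ (∀ x, f x ≤ 1) ∧ (∀ x ∈ K, f x = 1) ∧ (∀ x ∉ K₁, f x = 0) ∧
      ∀ x y, |f x - f y| ≤ dist x y / r := by
  rcases K.eq_empty_or_nonempty with rfl | hne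
  · exact ⟨1, one_pos, ∅, isCompact_empty, 0, 0, by simp, by simp, by simp, by simp, by simp,
      fun x y => by simp⟩
  obtain ⟨K₁, hK₁, hsub⟩ := exists_compact_superset hK
  obtain ⟨r, hr, hr'⟩ := hK.exists_thickening_subset_open isOpen_interior hsub
  set f : X → ℝ := fun x => max 0 (1 - Metric.infDist x K / r) with hf
  have hlip : ∀ x y, |f x - f y| ≤ dist x y / r := by
    intro x y
    have h1 : |Metric.infDist x K - Metric.infDist y K| ≤ dist x y := by
      simpa [Real.dist_eq] using (Metric.lipschitz_infDist_pt K).dist_le_mul x y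
    calc |f x - f y| ≤ max |(0 : ℝ) - 0|
            |1 - Metric.infDist x K / r - (1 - Metric.infDist y K / r)| :=
          abs_max_sub_max_le_max _ _ _ _
      _ = |Metric.infDist x K - Metric.infDist y K| / r := by
          rw [sub_zero, abs_zero, max_eq_right (abs_nonneg _), sub_sub_sub_cancel_left, ← sub_div,
            abs_div, abs_of_pos hr, abs_sub_comm]
      _ ≤ dist x y / r := by gcongr
  have h0 : ∀ x ∉ K₁, f x = 0 := by
    intro x hx
    have : r ≤ Metric.infDist x K := by
      by_contra! h
      exact hx (interior_subset (hr' (Metric.mem_thickening_iff_infDist_lt hne |>.2 h)))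
    simp only [hf]
    rw [max_eq_left]
    rw [sub_nonpos]
    exact (one_le_div hr).2 this
  have hc : Continuous f := by
    have := Metric.continuous_infDist_pt K
    fun_prop
  refine ⟨r, hr, K₁, hK₁, f, ofRealCompactSupport f hc hK₁ h0, fun x => rfl,
    fun x => le_max_left _ _, fun x => ?_, fun x hx => ?_, h0, hlip⟩
  · have : 0 ≤ Metric.infDist x K / r := div_nonneg Metric.infDist_nonneg hr.le
    exact max_le zero_le_one (by linarith)
  · simp [hf, Metric.infDist_zero_of_mem hx]

lemma exists_apply_eq_one [LocallyCompactSpace X] (x : X) : ∃ g : C₀(X, ℂ), g x = 1 := by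
  obtain ⟨r, hr, K₁, hK₁, f, e, he, -, -, h1, -⟩ :=
    exists_lipschitz_bump (isCompact_singleton (x := x))
  exact ⟨e, by rw [he, h1 x rfl, Complex.ofReal_one]⟩

end Bump

/-! ### Point evaluations on `𝔲 C₀(X)` -/

section Eval

lemma UA.exists_eq {A : Type u} [NonUnitalCStarAlgebra A] (u : UA A) :
    ∃ (a : A) (c : ℂ), u = incl a + algebraMap ℂ _ c := by
  obtain ⟨a, c, h⟩ := mem_smallestUnitization.1 u.2
  exact ⟨a, c, Subtype.ext h⟩

variable {X : Type u} [MetricSpace X]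

/-- The function `X → ℂ` defined by the action of `u` on a function that is `1` at the point. -/
def evalFun (g : C₀(X, ℂ)) (x : X) (u : UA C₀(X, ℂ)) : ℂ :=
  (show 𝓜(ℂ, C₀(X, ℂ)) from u.1).fst g x

/-- If `X` is compact, an element has many decompositions `incl a + c`, so evaluation cannot be
defined from one of them. Reading the value off the multiplier action at a `g` with `g x = 1` makes
it well defined from the start. -/
lemma evalFun_incl_add (g : C₀(X, ℂ)) (x : X) (a : C₀(X, ℂ)) (c : ℂ) :
    evalFun g x (incl a + algebraMap ℂ _ c) = (a x + c) * g x := by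
  change ((DoubleCentralizer.coeHom (𝕜 := ℂ) a + algebraMap ℂ 𝓜(ℂ, C₀(X, ℂ)) c).fst g) x = _
  simp [add_mul, Algebra.algebraMap_eq_smul_one]

variable [LocallyCompactSpace X]

/-- Evaluation at a point, as a character of `𝔲 C₀(X)`. -/
def ev (x : X) : UA C₀(X, ℂ) →⋆ₐ[ℂ] ℂ :=
  have key (a : C₀(X, ℂ)) (c : ℂ) :
      evalFun (exists_apply_eq_one x).choose x (incl a + algebraMap ℂ _ c) = a x + c := by
    rw [evalFun_incl_add, (exists_apply_eq_one x).choose_spec, mul_one]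
  have key1 (c : ℂ) : evalFun (exists_apply_eq_one x).choose x (algebraMap ℂ _ c) = c := by
    simpa using key 0 c
  { toFun := evalFun (exists_apply_eq_one x).choose x
    map_one' := by simpa using key1 1
    map_zero' := by simpa using key1 0
    map_mul' := fun u w => by
      obtain ⟨a, c, rfl⟩ := u.exists_eq
      obtain ⟨b, d, rfl⟩ := w.exists_eq
      rw [key, key, ← key b d]
      exact evalFun_incl_add _ x a c
    map_add' := fun u w => by
      obtain ⟨a, c, rfl⟩ := u.exists_eq
      obtain ⟨b, d, rfl⟩ := w.exists_eq
      rw [show (incl a + algebraMap ℂ (UA C₀(X, ℂ)) c) + (incl b + algebraMap ℂ _ d)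
        = incl (a + b) + algebraMap ℂ _ (c + d) by simp only [map_add]; abel, key, key, key]
      simp
      ring
    commutes' := key1
    map_star' := fun u => by
      obtain ⟨a, c, rfl⟩ := u.exists_eq
      rw [show star (incl a + algebraMap ℂ (UA C₀(X, ℂ)) c)
        = incl (star a) + algebraMap ℂ _ (star c) by
          rw [star_add, map_star, ← algebraMap_star_comm], key, key]
      simp }

@[simp]
lemma ev_incl (x : X) (a : C₀(X, ℂ)) : ev x (incl a) = a x := by
  have := evalFun_incl_add (exists_apply_eq_one x).choose x a 0
  rw [(exists_apply_eq_one x).choose_spec, map_zero, add_zero, add_zero, mul_one] at this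
  exact this

lemma ext_ev {u w : UA C₀(X, ℂ)} (h : ∀ x, ev x u = ev x w) : u = w := by
  rw [← sub_eq_zero]
  obtain ⟨a, c, hac⟩ := (u - w).exists_eq
  have hx (x : X) : a x + c = 0 := by
    have := congrArg (ev x) hac
    rw [map_sub, h, sub_self, map_add, ev_incl, AlgHomClass.commutes] at this
    exact this.symm
  rw [hac]
  refine Subtype.ext ?_
  change DoubleCentralizer.coeHom (𝕜 := ℂ) a + algebraMap ℂ 𝓜(ℂ, C₀(X, ℂ)) c = 0
  refine DoubleCentralizer.ext _ _ _ _ (Prod.ext ?_ ?_) <;>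
  · ext g x
    simp [Algebra.algebraMap_eq_smul_one]
    linear_combination (g x) * hx x

lemma UA.mul_comm (u w : UA C₀(X, ℂ)) : u * w = w * u :=
  ext_ev fun x => by rw [map_mul, map_mul, _root_.mul_comm]

lemma isSelfAdjoint_iff_ev {u : UA C₀(X, ℂ)} :
    IsSelfAdjoint u ↔ ∀ x, ((ev x u).re : ℂ) = ev x u := by
  constructor
  · intro h x
    have : star (ev x u) = ev x u := by rw [← map_star, h.star_eq]
    exact Complex.conj_eq_iff_re.1 this
  · intro h
    refine ext_ev fun x => ?_
    rw [map_star]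
    exact Complex.conj_eq_iff_re.2 (h x)

/-! ### Pointwise order -/

lemma ev_nonneg {u : UA C₀(X, ℂ)} (h : 0 ≤ u) (x : X) : 0 ≤ ev x u := by
  simpa using OrderHomClass.mono (ev x) h

@[simp]
lemma ev_abs (x : X) (u : UA C₀(X, ℂ)) : ev x (CFC.abs u) = (‖ev x u‖ : ℂ) := by
  have h0 := ev_nonneg (CFC.abs_nonneg u) x
  have h1 := congrArg (ev x) (CFC.abs_mul_abs u)
  rw [Complex.nonneg_iff] at h0
  have h2 : ev x (CFC.abs u) = ((ev x (CFC.abs u)).re : ℂ) := by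
    apply Complex.ext <;> simp [← h0.2]
  rw [map_mul, map_mul, map_star, h2] at h1
  rw [h2]
  have h3 : (ev x (CFC.abs u)).re ^ 2 = ‖ev x u‖ ^ 2 := by
    rw [← Complex.ofReal_inj]
    push_cast
    rw [sq, h1]
    exact Complex.conj_mul' _
  exact congrArg _ ((sq_eq_sq₀ h0.1 (norm_nonneg _)).1 h3)

/-- Points separate elements, so a pointwise nonnegative `u` coincides with `|u|`. -/
lemma nonneg_of_ev {u : UA C₀(X, ℂ)} (h : ∀ x, 0 ≤ ev x u) : 0 ≤ u := by
  have h1 : CFC.abs u = u := ext_ev fun x => by rw [ev_abs, Complex.norm_of_nonneg' (h x)]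
  rw [← h1]
  exact CFC.abs_nonneg u

end Eval

/-! ### Lipschitz constants -/

section Lipschitz

variable {X : Type u} [MetricSpace X]

/-- The Lipschitz constant of a function, in `[0, ∞]`. -/
def lipConst (F : X → ℂ) : ℝ≥0∞ :=
  ⨆ (x : X) (y : X) (_ : x ≠ y), edist (F y) (F x) / edist y x

lemma lipConst_le_iff {F : X → ℂ} {C : ℝ≥0∞} :
    lipConst F ≤ C ↔ ∀ x y, edist (F x) (F y) ≤ C * edist x y := by
  simp only [lipConst, iSup_le_iff]
  constructor
  · intro h x y
    rcases eq_or_ne y x with rfl | hxy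
    · simp
    · exact (ENNReal.div_le_iff (edist_pos.2 hxy.symm).ne' (edist_ne_top _ _)).1 (h y x hxy)
  · intro h x y hxy
    exact (ENNReal.div_le_iff (edist_pos.2 hxy.symm).ne' (edist_ne_top _ _)).2 (h y x)

lemma edist_le_lipConst (F : X → ℂ) (x y : X) :
    edist (F x) (F y) ≤ lipConst F * edist x y :=
  lipConst_le_iff.1 le_rfl x y

lemma lipConst_le_ofReal_iff {F : X → ℂ} {C : ℝ} (hC : 0 ≤ C) :
    lipConst F ≤ ENNReal.ofReal C ↔ ∀ x y, ‖F x - F y‖ ≤ C * dist x y := by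
  rw [lipConst_le_iff]
  refine forall₂_congr fun x y => ?_
  rw [edist_dist, edist_dist, ← ENNReal.ofReal_mul hC,
    ENNReal.ofReal_le_ofReal_iff (by positivity), dist_eq_norm]

lemma lipConst_le_one_iff {F : X → ℂ} : lipConst F ≤ 1 ↔ ∀ x y, ‖F x - F y‖ ≤ dist x y := by
  simpa using lipConst_le_ofReal_iff (F := F) zero_le_one

lemma lipConst_add_le (F G : X → ℂ) : lipConst (F + G) ≤ lipConst F + lipConst G := by
  refine lipConst_le_iff.2 fun x y => ?_
  rw [add_mul]
  exact (edist_add_add_le _ _ _ _).trans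
    (add_le_add (edist_le_lipConst F x y) (edist_le_lipConst G x y))

lemma lipConst_add_const (F : X → ℂ) (c : ℂ) : lipConst (fun x => F x + c) = lipConst F := by
  simp [lipConst]

lemma lipConst_smul_le (t : ℝ) (F : X → ℂ) : lipConst (t • F) ≤ ‖t‖ₑ * lipConst F := by
  refine lipConst_le_iff.2 fun x y => ?_
  rw [mul_assoc, Pi.smul_apply, Pi.smul_apply, edist_smul₀]
  exact mul_le_mul_right (edist_le_lipConst F x y) _

lemma lipConst_smul (t : ℝ) (F : X → ℂ) : lipConst (t • F) = ‖t‖ₑ * lipConst F := by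
  rcases eq_or_ne t 0 with rfl | ht
  · simp [lipConst]
  refine le_antisymm (lipConst_smul_le t F) ?_
  have h := lipConst_smul_le t⁻¹ (t • F)
  rw [inv_smul_smul₀ ht, enorm_inv ht] at h
  calc ‖t‖ₑ * lipConst F ≤ ‖t‖ₑ * (‖t‖ₑ⁻¹ * lipConst (t • F)) := by gcongr
    _ = lipConst (t • F) := by
      rw [← mul_assoc, ENNReal.mul_inv_cancel (by simpa using ht) (by simp), one_mul]

lemma lipConst_eq_zero_iff {F : X → ℂ} : lipConst F = 0 ↔ ∀ x y, F x = F y := by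
  rw [← nonpos_iff_eq_zero, lipConst_le_iff]
  simp

lemma isSelfAdjoint_iff_apply {a : C₀(X, ℂ)} :
    IsSelfAdjoint a ↔ ∀ x, ((a x).re : ℂ) = a x := by
  rw [isSelfAdjoint_iff, DFunLike.ext_iff]
  exact forall_congr' fun x => Complex.conj_eq_iff_re

/-- Infimal convolution `x ↦ inf_y (f y + n d(x, y))`. It is `n`-Lipschitz and lies between `0` and
`f`, so it inherits the decay of `f` at infinity. -/
lemma exists_lipschitz_approx_nonneg {f : X → ℝ} (hf : UniformContinuous f) (h0 : ∀ x, 0 ≤ f x)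
    {C : ℝ} (hC : ∀ x, f x ≤ C) {ε : ℝ} (hε : 0 < ε) :
    ∃ (g : X → ℝ) (n : ℝ), 0 ≤ n ∧ (∀ x y, |g x - g y| ≤ n * dist x y) ∧ (∀ x, 0 ≤ g x) ∧
      (∀ x, g x ≤ f x) ∧ ∀ x, f x ≤ g x + ε := by
  obtain ⟨δ, hδ, hfδ⟩ := Metric.uniformContinuous_iff.1 hf ε hε
  -- With this slope the penalty at distance at least `δ` is at least `|C| ≥ f x`; closer points are
  -- handled by uniform continuity.
  set n : ℝ := |C| / δ with hn
  have hn0 : 0 ≤ n := by positivity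
  have hnn (x y : X) : 0 ≤ f y + n * dist x y := add_nonneg (h0 y) (by positivity)
  have hb (x : X) : BddBelow (Set.range fun y => f y + n * dist x y) :=
    ⟨0, by rintro _ ⟨y, rfl⟩; exact hnn x y⟩
  have hle (x y : X) :
      (⨅ z, (f z + n * dist x z)) ≤ (⨅ z, (f z + n * dist y z)) + n * dist x y := by
    have : Nonempty X := ⟨x⟩
    rw [← sub_le_iff_le_add]
    refine le_ciInf fun z => ?_
    have h1 := ciInf_le (hb x) z
    have h2 := mul_le_mul_of_nonneg_left (dist_triangle x y z) hn0
    linarith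
  refine ⟨fun x => ⨅ y, (f y + n * dist x y), n, hn0, fun x y => ?_, fun x => ?_, fun x => ?_,
    fun x => ?_⟩
  · rw [abs_sub_le_iff]
    have h1 := hle x y
    have h2 := hle y x
    rw [dist_comm y x] at h2
    constructor <;> linarith
  · exact Real.iInf_nonneg (hnn x)
  · simpa using ciInf_le (hb x) x
  · have : Nonempty X := ⟨x⟩
    rw [← sub_le_iff_le_add]
    refine le_ciInf fun y => ?_
    rcases lt_or_ge (dist x y) δ with h | h
    · have h1 := hfδ h
      rw [Real.dist_eq] at h1
      have h2 := le_abs_self (f x - f y)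
      have h3 : 0 ≤ n * dist x y := by positivity
      linarith
    · have h1 : |C| ≤ n * dist x y := by
        calc |C| = n * δ := by rw [hn, div_mul_cancel₀ _ hδ.ne']
          _ ≤ n * dist x y := by gcongr
      have h2 := le_abs_self C
      linarith [hC x, h0 y]

/-- The positive and negative parts are approximated from below separately; the difference is then
dominated by `|a|`, which makes it vanish at infinity. -/
lemma exists_lipschitz_approx {a : C₀(X, ℂ)} (ha : IsSelfAdjoint a) {ε : ℝ} (hε : 0 < ε) :
    ∃ b : C₀(X, ℂ), IsSelfAdjoint b ∧ lipSeminorm b < ∞ ∧ ‖a - b‖ ≤ ε := by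
  have huc : UniformContinuous fun x => (a x).re :=
    Complex.reCLM.uniformContinuous.comp (ZeroAtInftyContinuousMap.uniformContinuous a)
  have hlim : Filter.Tendsto (fun x => (a x).re) (Filter.cocompact X) (𝓝 0) := by
    simpa [Function.comp_def] using (Complex.continuous_re.tendsto 0).comp (zero_at_infty a)
  have hbd (x : X) : |(a x).re| ≤ ‖a‖ :=
    (Complex.abs_re_le_norm _).trans (a.toBCF.norm_coe_le_norm x)
  obtain ⟨g, n, hn, hgl, hg0, hgf, hfg⟩ := exists_lipschitz_approx_nonneg
    (f := fun x => max (a x).re 0) ((LipschitzWith.id.max_const 0).uniformContinuous.comp huc)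
    (fun x => le_max_right _ _)
    (C := ‖a‖) (fun x => max_le ((le_abs_self _).trans (hbd x)) (norm_nonneg _)) hε
  obtain ⟨k, m, hm, hkl, hk0, hkf, hfk⟩ := exists_lipschitz_approx_nonneg
    (f := fun x => max (-(a x).re) 0)
    ((LipschitzWith.id.max_const 0).uniformContinuous.comp huc.neg)
    (fun x => le_max_right _ _)
    (C := ‖a‖) (fun x => max_le ((neg_le_abs _).trans (hbd x)) (norm_nonneg _)) hε
  have hlip (x y : X) : |(g x - k x) - (g y - k y)| ≤ (n + m) * dist x y := by
    rw [sub_sub_sub_comm, add_mul]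
    exact (abs_sub _ _).trans (add_le_add (hgl x y) (hkl x y))
  have hgk (x : X) : |g x - k x| ≤ |(a x).re| := by
    have h1 := hgf x
    have h2 := hkf x
    have h3 := hg0 x
    have h4 := hk0 x
    rcases le_total 0 (a x).re with h | h
    · rw [max_eq_left h] at h1
      rw [max_eq_right (by linarith)] at h2
      rw [abs_of_nonneg h, abs_le]
      constructor <;> linarith
    · rw [max_eq_right h] at h1
      rw [max_eq_left (by linarith)] at h2
      rw [abs_of_nonpos h, abs_le]
      constructor <;> linarith
  have happ (x : X) : |(a x).re - (g x - k x)| ≤ ε := by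
    have h1 := hfg x
    have h2 := hfk x
    have h5 := hgf x
    have h6 := hkf x
    have h7 : (a x).re = max (a x).re 0 - max (-(a x).re) 0 := by
      rcases le_total 0 (a x).re with h | h
      · rw [max_eq_left h, max_eq_right (by linarith), sub_zero]
      · rw [max_eq_right h, max_eq_left (by linarith)]; ring
    rw [abs_le]
    constructor <;> linarith
  have hlc : LipschitzWith (Real.toNNReal (n + m)) fun x => g x - k x :=
    LipschitzWith.of_dist_le_mul fun x y => by
      rw [Real.dist_eq, Real.coe_toNNReal _ (add_nonneg hn hm)]
      exact hlip x y
  let b : C₀(X, ℂ) :=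
    { toFun := fun x => ((g x - k x : ℝ) : ℂ)
      continuous_toFun := Complex.continuous_ofReal.comp hlc.continuous
      zero_at_infty' := by
        refine squeeze_zero_norm (a := fun x => |(a x).re|) (fun x => ?_) (by simpa using hlim.abs)
        rw [Complex.norm_real]
        exact hgk x }
  have hb (x : X) : b x = ((g x - k x : ℝ) : ℂ) := rfl
  refine ⟨b, isSelfAdjoint_iff_apply.2 fun x => by rw [hb, Complex.ofReal_re], ?_, ?_⟩
  · refine lt_of_le_of_lt (?_ : lipConst b ≤ ENNReal.ofReal (n + m)) ENNReal.ofReal_lt_top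
    refine (lipConst_le_ofReal_iff (add_nonneg hn hm)).2 fun x y => ?_
    rw [hb, hb, ← Complex.ofReal_sub, Complex.norm_real]
    exact hlip x y
  · refine (BoundedContinuousFunction.norm_le (f := (a - b).toBCF) hε.le).2 fun x => ?_
    change ‖a x - b x‖ ≤ ε
    rw [← isSelfAdjoint_iff_apply.1 ha, hb, ← Complex.ofReal_sub, Complex.norm_real]
    exact happ x

variable [LocallyCompactSpace X]

@[simp]
lemma ev_algebraMap (x : X) (c : ℂ) : ev x (algebraMap ℂ (UA C₀(X, ℂ)) c) = c :=
  AlgHomClass.commutes (ev x) c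

@[simp]
lemma ev_real_smul (x : X) (t : ℝ) (u : UA C₀(X, ℂ)) : ev x (t • u) = t * ev x u := by
  change ev x ((t : ℂ) • u) = t * ev x u
  rw [map_smul, smul_eq_mul]

lemma isSelfAdjoint_incl_iff {a : C₀(X, ℂ)} : IsSelfAdjoint (incl a) ↔ IsSelfAdjoint a := by
  rw [isSelfAdjoint_iff_ev, isSelfAdjoint_iff_apply]
  simp

lemma UA.exists_eq_of_isSelfAdjoint {u : UA C₀(X, ℂ)} (hu : IsSelfAdjoint u) :
    ∃ (a : C₀(X, ℂ)) (t : ℝ), IsSelfAdjoint a ∧ u = incl a + t • (1 : UA C₀(X, ℂ)) := by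
  obtain ⟨b, c, rfl⟩ := u.exists_eq
  rw [isSelfAdjoint_iff_ev] at hu
  have key (x : X) : (1 / 2 : ℂ) * (b x + star (b x)) = ((b x).re : ℂ) := by
    apply Complex.ext <;> simp; ring
  refine ⟨(1 / 2 : ℂ) • (b + star b), c.re, isSelfAdjoint_iff_apply.2 fun x => ?_,
    ext_ev fun x => ?_⟩
  · change ((((1 / 2 : ℂ) * (b x + star (b x))).re : ℝ) : ℂ) = (1 / 2 : ℂ) * (b x + star (b x))
    rw [key, Complex.ofReal_re]
  · rw [← hu, map_add, map_add, ev_incl, ev_incl, ev_algebraMap, ev_real_smul, map_one, mul_one]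
    change _ = (1 / 2 : ℂ) * (b x + star (b x)) + _
    rw [key, Complex.add_re, Complex.ofReal_add]

/-- Adding a constant does not change a Lipschitz constant, so all decompositions in the infimum
give the same value. -/
lemma unitalExtension_eq {u : UA C₀(X, ℂ)} (hu : IsSelfAdjoint u) :
    unitalExtension lipSeminorm u = lipConst fun x => ev x u := by
  have key (a : C₀(X, ℂ)) (t : ℝ) :
      lipConst (fun x => ev x (incl a + t • (1 : UA C₀(X, ℂ)))) = lipSeminorm a := by
    simp only [map_add, ev_incl, ev_real_smul, map_one, lipConst_add_const]
    rfl
  refine le_antisymm ?_ ?_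
  · obtain ⟨a, t, ha, h⟩ := UA.exists_eq_of_isSelfAdjoint hu
    refine (iInf₂_le a t).trans ((iInf₂_le ha h).trans ?_)
    rw [h, key]
  · refine le_iInf₂ fun a t => le_iInf₂ fun ha h => ?_
    rw [h, key]

lemma norm_incl {A : Type u} [NonUnitalCStarAlgebra A] (a : A) : ‖incl a‖ = ‖a‖ :=
  norm_coeHom a

lemma unitalExtension_incl {a : C₀(X, ℂ)} (ha : IsSelfAdjoint a) :
    unitalExtension lipSeminorm (incl a) = lipSeminorm a := by
  rw [unitalExtension_eq (isSelfAdjoint_incl_iff.2 ha)]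
  simp only [ev_incl]
  rfl

lemma isLipschitzPair_unitalExtension_lipSeminorm :
    IsLipschitzPair (unitalExtension (lipSeminorm (X := X))) where
  add_le a b ha hb := by
    rw [unitalExtension_eq ha, unitalExtension_eq hb, unitalExtension_eq (ha.add hb)]
    simp only [map_add]
    exact lipConst_add_le _ _
  smul t a ha := by
    rw [unitalExtension_eq ha, unitalExtension_eq ((IsSelfAdjoint.all t).smul ha), ← lipConst_smul]
    simp only [ev_real_smul]
    rfl
  dense u hu := by
    obtain ⟨a, t, ha, rfl⟩ := UA.exists_eq_of_isSelfAdjoint hu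
    refine Metric.mem_closure_iff.2 fun ε hε => ?_
    obtain ⟨b, hb, hlb, hab⟩ := exists_lipschitz_approx ha (half_pos hε)
    have hsb : IsSelfAdjoint (incl b + t • (1 : UA C₀(X, ℂ))) :=
      (isSelfAdjoint_incl_iff.2 hb).add ((IsSelfAdjoint.all t).smul (.one _))
    refine ⟨incl b + t • 1, ⟨hsb, ?_⟩, ?_⟩
    · rw [unitalExtension_eq hsb]
      simp only [map_add, ev_incl, ev_real_smul, map_one, lipConst_add_const]
      exact hlb
    · rw [dist_add_right, dist_eq_norm, ← map_sub, norm_incl]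
      linarith
  eq_zero_iff u hu := by
    rw [unitalExtension_eq hu, lipConst_eq_zero_iff]
    constructor
    · intro h
      rcases isEmpty_or_nonempty X with hX | ⟨⟨x₀⟩⟩
      · exact ⟨0, ext_ev fun x => isEmptyElim x⟩
      · refine ⟨(ev x₀ u).re, ext_ev fun x => ?_⟩
        rw [ev_real_smul, map_one, mul_one, isSelfAdjoint_iff_ev.1 hu, h]
    · rintro ⟨t, rfl⟩ x y
      simp

lemma isTopography_top {A : Type u} [NonUnitalCStarAlgebra A] (h : ∀ a b : A, a * b = b * a) :
    IsTopography (⊤ : NonUnitalStarSubalgebra ℂ A) where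
  isClosed := isClosed_univ
  comm a _ b _ := h a b
  approximateUnit := by
    let _ := CStarAlgebra.spectralOrder A
    have := CStarAlgebra.spectralOrderedRing A
    exact ⟨_, CStarAlgebra.increasingApproximateUnit A, Filter.univ_mem⟩

end Lipschitz

/-! ### The Gel'fand spectrum of `C₀(X)` -/

section Spectrum

variable {X : Type u} [MetricSpace X]

lemma isCompact_setOf_le_norm (f : C₀(X, ℂ)) {c : ℝ} (hc : 0 < c) :
    IsCompact {x | c ≤ ‖f x‖} := by
  have h : ∀ᶠ x in Filter.cocompact X, ‖f x‖ < c := by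
    have := (zero_at_infty f).norm
    rw [norm_zero] at this
    exact this.eventually_lt_const hc
  obtain ⟨t, ht, hsub⟩ := Filter.mem_cocompact.1 h
  refine ht.of_isClosed_subset (isClosed_le continuous_const (map_continuous f).norm) fun x hx => ?_
  by_contra hxt
  have h1 : ‖f x‖ < c := hsub hxt
  exact absurd hx (not_le.2 h1)

/-- The product of a function vanishing at infinity with a bounded continuous function. -/
def mulBounded (f : C₀(X, ℂ)) (q : X → ℂ) (hq : Continuous q) (C : ℝ) (hC : ∀ x, ‖q x‖ ≤ C) :
    C₀(X, ℂ) where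
  toFun x := f x * q x
  continuous_toFun := (map_continuous f).mul hq
  zero_at_infty' := by
    refine squeeze_zero_norm (a := fun x => ‖f x‖ * C) (fun x => ?_) ?_
    · rw [norm_mul]
      exact mul_le_mul_of_nonneg_left (hC x) (norm_nonneg _)
    · simpa using (zero_at_infty f).norm.mul_const C

/-- If the kernel has no common zero, compactness gives a finite sum of functions `|f|²`, with `f`
in the kernel, that is positive on `K`. -/
lemma exists_pos_on_isCompact_of_ker {χ : C₀(X, ℂ) →ₗ[ℂ] ℂ} (hmul : ∀ f g, χ (f * g) = χ f * χ g)
    (hker : ∀ x, ∃ f, χ f = 0 ∧ f x ≠ 0) {K : Set X} (hK : IsCompact K) :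
    ∃ (h : X → ℝ) (k : C₀(X, ℂ)), (∀ x, k x = h x) ∧ χ k = 0 ∧ (∀ x, 0 ≤ h x) ∧
      ∀ x ∈ K, 0 < h x := by
  refine hK.induction_on ⟨0, 0, by simp⟩ ?_ ?_ ?_
  · rintro s t hst ⟨h, k, h1, h2, h3, h4⟩
    exact ⟨h, k, h1, h2, h3, fun x hx => h4 x (hst hx)⟩
  · rintro s t ⟨h, k, h1, h2, h3, h4⟩ ⟨h', k', h1', h2', h3', h4'⟩
    refine ⟨h + h', k + k', fun x => ?_, by rw [map_add, h2, h2', add_zero],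
      fun x => add_nonneg (h3 x) (h3' x), ?_⟩
    · rw [ZeroAtInftyContinuousMap.add_apply, h1, h1', Pi.add_apply, Complex.ofReal_add]
    · rintro x (hx | hx)
      · exact add_pos_of_pos_of_nonneg (h4 x hx) (h3' x)
      · exact add_pos_of_nonneg_of_pos (h3 x) (h4' x hx)
  · intro x _
    obtain ⟨f, hf, hfx⟩ := hker x
    refine ⟨{y | f y ≠ 0}, mem_nhdsWithin_of_mem_nhds
      ((isOpen_ne_fun (map_continuous f) continuous_const).mem_nhds hfx),
      fun y => ‖f y‖ ^ 2, f * star f, fun y => ?_, by rw [hmul, hf, zero_mul],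
      fun y => sq_nonneg _, fun y hy => by have : f y ≠ 0 := hy; positivity⟩
    rw [ZeroAtInftyContinuousMap.mul_apply, ZeroAtInftyContinuousMap.star_apply]
    simpa using Complex.mul_conj' (f y)

/-- Were the kernel without a common zero, it would be dense: `f` is close to `k f / (h + δ)` with
`k = h` in the kernel and positive where `|f|` is large. Since the kernel is closed, `χ` would
vanish. At a common zero `x`, evaluation is a multiple of `χ`, and multiplicativity forces the
factor to be `1`. -/
lemma exists_eval_eq_of_mul {χ : C₀(X, ℂ) →ₗ[ℂ] ℂ} (hc : Continuous χ)
    (hmul : ∀ f g, χ (f * g) = χ f * χ g) (hne : ∃ f, χ f ≠ 0) [LocallyCompactSpace X] :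
    ∃ x, ∀ f, χ f = f x := by
  by_cases hker : ∀ x, ∃ f, χ f = 0 ∧ f x ≠ 0
  · exfalso
    obtain ⟨f, hf⟩ := hne
    refine hf ?_
    have hcl : IsClosed {g | χ g = 0} := isClosed_eq hc continuous_const
    refine hcl.closure_subset (Metric.mem_closure_iff.2 fun ε hε => ?_)
    have hε2 := half_pos hε
    have hK := isCompact_setOf_le_norm f hε2
    obtain ⟨h, k, hk, hχk, h0, hpos⟩ := exists_pos_on_isCompact_of_ker hmul hker hK
    have hcont : Continuous h := by
      have : h = fun x => (k x).re := by ext x; rw [hk, Complex.ofReal_re]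
      rw [this]
      exact Complex.continuous_re.comp (map_continuous k)
    obtain ⟨c, hc0, hcK⟩ : ∃ c > 0, ∀ x ∈ {x | ε / 2 ≤ ‖f x‖}, c ≤ h x := by
      rcases Set.eq_empty_or_nonempty {x | ε / 2 ≤ ‖f x‖} with he | hne
      · exact ⟨1, one_pos, by simp [he]⟩
      · obtain ⟨x, hx, hmin⟩ := hK.exists_isMinOn hne hcont.continuousOn
        exact ⟨h x, hpos x hx, fun y hy => hmin hy⟩
    -- The error is `f δ / (h + δ)`. This `δ` makes it at most `ε / 2` where `h ≥ c`; elsewhere `|f|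
    -- < ε / 2` suffices.
    obtain ⟨δ, hδ, hδ'⟩ : ∃ δ > 0, ‖f‖ * δ ≤ ε / 2 * c := by
      refine ⟨ε / 2 * c / (‖f‖ + 1), by positivity, ?_⟩
      rw [← mul_div_assoc, div_le_iff₀ (by positivity)]
      nlinarith [norm_nonneg f, mul_pos hε2 hc0]
    have hden (x : X) : 0 < h x + δ := by linarith [h0 x]
    have hq : Continuous fun x => (((h x + δ)⁻¹ : ℝ) : ℂ) :=
      Complex.continuous_ofReal.comp
        ((hcont.add continuous_const).inv₀ fun x => (hden x).ne')
    refine ⟨k * mulBounded f _ hq δ⁻¹ fun x => ?_, ?_, ?_⟩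
    · rw [Complex.norm_real, Real.norm_of_nonneg (inv_nonneg.2 (hden x).le)]
      exact inv_anti₀ hδ (by linarith [h0 x])
    · change χ _ = 0
      rw [hmul, hχk, zero_mul]
    · refine lt_of_le_of_lt ?_ (half_lt_self hε)
      rw [dist_eq_norm]
      refine (BoundedContinuousFunction.norm_le (f := ZeroAtInftyContinuousMap.toBCF _)
        hε2.le).2 fun x => ?_
      change ‖f x - k x * (f x * (((h x + δ)⁻¹ : ℝ) : ℂ))‖ ≤ _
      have e1 : f x - k x * (f x * (((h x + δ)⁻¹ : ℝ) : ℂ)) = f x * ((δ / (h x + δ) : ℝ) : ℂ) := by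
        have : ((h x + δ : ℝ) : ℂ) ≠ 0 := Complex.ofReal_ne_zero.2 (hden x).ne'
        rw [hk]
        push_cast at this ⊢
        field_simp
        ring
      have hfx : ‖f x‖ ≤ ‖f‖ := f.toBCF.norm_coe_le_norm x
      rw [e1, norm_mul, Complex.norm_real, Real.norm_of_nonneg (div_nonneg hδ.le (hden x).le)]
      rcases le_or_gt (ε / 2) ‖f x‖ with hx | hx
      · rw [← mul_div_assoc, div_le_iff₀ (hden x)]
        calc ‖f x‖ * δ ≤ ‖f‖ * δ := by gcongr
          _ ≤ ε / 2 * c := hδ'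
          _ ≤ ε / 2 * (h x + δ) := by gcongr; linarith [hcK x hx]
      · calc ‖f x‖ * (δ / (h x + δ)) ≤ ‖f x‖ * 1 := by
              gcongr
              exact (div_le_one (hden x)).2 (by linarith [h0 x])
          _ ≤ ε / 2 := by linarith
  · push Not at hker
    obtain ⟨x, hx⟩ := hker
    obtain ⟨f₀, hf₀⟩ := hne
    set g := (χ f₀)⁻¹ • f₀ with hg
    have hg1 : χ g = 1 := by rw [hg, map_smul, smul_eq_mul, inv_mul_cancel₀ hf₀]
    have key (f : C₀(X, ℂ)) : f x = χ f * g x := by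
      have := hx (f - χ f • g) (by rw [map_sub, map_smul, hg1, smul_eq_mul, mul_one, sub_self])
      rw [ZeroAtInftyContinuousMap.sub_apply, sub_eq_zero] at this
      exact this
    have h2 : g x * g x = g x := by
      have := key (g * g)
      rwa [hmul, hg1, one_mul, one_mul] at this
    have h3 : g x ≠ 0 := fun h0 => by
      obtain ⟨f, hf⟩ := exists_apply_eq_one x
      have := key f
      rw [hf, h0, mul_zero] at this
      exact one_ne_zero this
    have h4 : g x = 1 := mul_right_cancel₀ h3 (by rw [h2, one_mul])
    exact ⟨x, fun f => by rw [key f, h4, mul_one]⟩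

variable [LocallyCompactSpace X]

lemma Spec.exists_eval_eq (χ : Spec (⊤ : NonUnitalStarSubalgebra ℂ C₀(X, ℂ))) :
    ∃ x, ∀ f : (⊤ : NonUnitalStarSubalgebra ℂ C₀(X, ℂ)), χ f = (f : C₀(X, ℂ)) x := by
  let ι : C₀(X, ℂ) →ₗ[ℂ] (⊤ : NonUnitalStarSubalgebra ℂ C₀(X, ℂ)) :=
    { toFun := fun f => ⟨f, trivial⟩
      map_add' := fun _ _ => rfl
      map_smul' := fun _ _ => rfl }
  let ξ : (⊤ : NonUnitalStarSubalgebra ℂ C₀(X, ℂ)) →ₗ[ℂ] ℂ :=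
    { toFun := fun f => χ f
      map_add' := map_add χ
      map_smul' := map_smul χ }
  have hξ : Continuous ξ := ContinuousLinearMap.continuous (WeakDual.toStrongDual χ.1)
  have hι : Continuous ι := continuous_id.subtype_mk _
  obtain ⟨x, hx⟩ := exists_eval_eq_of_mul (χ := ξ ∘ₗ ι) (hξ.comp hι)
    (fun f g => map_mul χ (ι f) (ι g)) (by
      by_contra! h
      exact χ.2.1 (DFunLike.ext _ _ fun f : (⊤ : NonUnitalStarSubalgebra ℂ C₀(X, ℂ)) => h f))
  exact ⟨x, fun f => hx f⟩

/-- The point evaluations, as points of the spectrum. -/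
def evalChar (x : X) : Spec (⊤ : NonUnitalStarSubalgebra ℂ C₀(X, ℂ)) :=
  ⟨StrongDual.toWeakDual
    (LinearMap.mkContinuous
      { toFun := fun f : (⊤ : NonUnitalStarSubalgebra ℂ C₀(X, ℂ)) => (f : C₀(X, ℂ)) x
        map_add' := fun _ _ => rfl
        map_smul' := fun _ _ => rfl } 1
      fun f => by
        rw [one_mul]
        exact (f : C₀(X, ℂ)).toBCF.norm_coe_le_norm x),
    fun h => by
      obtain ⟨g, hg⟩ := exists_apply_eq_one x
      have : g x = 0 := DFunLike.congr_fun h ⟨g, trivial⟩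
      rw [hg] at this
      exact one_ne_zero this,
    fun _ _ => rfl⟩

lemma continuous_evalChar : Continuous (evalChar : X → Spec _) :=
  Continuous.subtype_mk (WeakDual.continuous_of_continuous_eval
    fun f : (⊤ : NonUnitalStarSubalgebra ℂ C₀(X, ℂ)) => map_continuous (f : C₀(X, ℂ))) _

/-- The compact set of the points of `X` whose evaluations lie in `K`. -/
def pointSet (K : TopologicalSpace.Compacts (Spec (⊤ : NonUnitalStarSubalgebra ℂ C₀(X, ℂ)))) :
    Set X :=
  {x | evalChar x ∈ K}

/-- Near the evaluation at `x`, a `g` with `g x = 1` satisfies `|ξ g| > 1/2`, which confines the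
points to the compact set `{|g| ≥ 1/2}`. Finitely many such neighbourhoods cover `K`. -/
lemma isCompact_pointSet
    (K : TopologicalSpace.Compacts (Spec (⊤ : NonUnitalStarSubalgebra ℂ C₀(X, ℂ)))) :
    IsCompact (pointSet K) := by
  obtain ⟨C, hC, hsub⟩ : ∃ C : Set X, IsCompact C ∧
      ∀ x, evalChar x ∈ (K : Set (Spec _)) → x ∈ C := by
    refine K.isCompact.induction_on ⟨∅, isCompact_empty, by simp⟩ ?_ ?_ ?_
    · rintro s t hst ⟨C, hC, h⟩
      exact ⟨C, hC, fun x hx => h x (hst hx)⟩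
    · rintro s t ⟨C, hC, h⟩ ⟨C', hC', h'⟩
      exact ⟨C ∪ C', hC.union hC', fun x hx => hx.imp (h x) (h' x)⟩
    · intro χ _
      obtain ⟨x, hx⟩ := Spec.exists_eval_eq χ
      obtain ⟨g, hg⟩ := exists_apply_eq_one x
      refine ⟨{ξ | 1 / 2 < ‖ξ ⟨g, trivial⟩‖}, mem_nhdsWithin_of_mem_nhds (IsOpen.mem_nhds ?_ ?_),
        _, isCompact_setOf_le_norm g one_half_pos, fun y hy => ?_⟩
      · exact isOpen_lt continuous_const
          ((WeakDual.eval_continuous _).comp continuous_subtype_val).norm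
      · change 1 / 2 < ‖χ ⟨g, trivial⟩‖
        rw [hx, hg, norm_one]
        norm_num
      · have h : 1 / 2 < ‖g y‖ := hy
        exact h.le
  exact hC.of_isClosed_subset (K.isCompact.isClosed.preimage continuous_evalChar) hsub

lemma forall_mem_apply_eq_zero
    {K : TopologicalSpace.Compacts (Spec (⊤ : NonUnitalStarSubalgebra ℂ C₀(X, ℂ)))}
    {f : (⊤ : NonUnitalStarSubalgebra ℂ C₀(X, ℂ))} :
    (∀ χ ∈ K, χ f = 0) ↔ ∀ x ∈ pointSet K, (f : C₀(X, ℂ)) x = 0 := by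
  constructor
  · intro h x hx
    exact h (evalChar x) hx
  · intro h χ hχ
    obtain ⟨x, hx⟩ := Spec.exists_eval_eq χ
    rw [hx]
    refine h x ?_
    have : evalChar x = χ := by
      ext f
      exact (hx f).symm
    rwa [← this] at hχ

end Spectrum

/-! ### Vector functionals of the universal representation -/

section VectorFunctional

variable {A : Type u} [NonUnitalCStarAlgebra A]

/-- The positive linear functional `u ↦ ⟪v, u v⟫` on `𝔲A` defined by a vector `v` of the universal
Hilbert space. -/
def vectorFunctional (v : UniversalSpace A) : UA A →ₗ[ℂ] ℂ where
  toFun u := ⟪v, universalRep u v⟫_ℂ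
  map_add' u w := by rw [map_add, add_apply, inner_add_right]
  map_smul' c u := by
    rw [map_smul, smul_apply, inner_smul_right]; rfl

lemma vectorFunctional_apply (v : UniversalSpace A) (u : UA A) :
    vectorFunctional v u = ⟪v, universalRep u v⟫_ℂ := rfl

lemma universalRep_mul_apply (u w : UA A) (v : UniversalSpace A) :
    universalRep (u * w) v = universalRep u (universalRep w v) := by
  rw [map_mul]; rfl

lemma inner_universalRep_star (u : UA A) (v w : UniversalSpace A) :
    ⟪v, universalRep (star u) w⟫_ℂ = ⟪universalRep u v, w⟫_ℂ := by
  rw [map_star]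
  exact ContinuousLinearMap.adjoint_inner_right _ _ _

lemma norm_universalRep_apply_le (u : UA A) (v : UniversalSpace A) :
    ‖universalRep u v‖ ≤ ‖u‖ * ‖v‖ :=
  (ContinuousLinearMap.le_opNorm _ _).trans (mul_le_mul_of_nonneg_right
    (NonUnitalStarAlgHom.norm_apply_le universalRep u) (norm_nonneg _))

lemma vectorFunctional_nonneg (v : UniversalSpace A) {u : UA A} (hu : 0 ≤ u) :
    0 ≤ vectorFunctional v u := by
  obtain ⟨s, rfl⟩ := CStarAlgebra.nonneg_iff_eq_star_mul_self.1 hu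
  rw [vectorFunctional_apply, universalRep_mul_apply, inner_universalRep_star,
    inner_self_eq_norm_sq_to_K]
  rw [← RCLike.ofReal_pow]
  exact RCLike.ofReal_nonneg.2 (sq_nonneg _)

lemma vectorFunctional_one (v : UniversalSpace A) :
    vectorFunctional v (1 : UA A) = ((‖v‖ ^ 2 : ℝ) : ℂ) := by
  rw [vectorFunctional_apply, map_one]
  change ⟪v, v⟫_ℂ = _
  rw [inner_self_eq_norm_sq_to_K]
  simp

lemma vectorFunctional_stateVector (φ : StateSpace A) (u : UA A) :
    vectorFunctional (stateVector φ) u = φ.eval u :=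
  φ.normalExtension_universalRep u

lemma norm_stateVector (φ : StateSpace A) : ‖stateVector φ‖ = 1 := by
  have h := vectorFunctional_one (stateVector φ)
  rw [vectorFunctional_stateVector, StateSpace.eval, φ.2.1] at h
  have h2 : ‖stateVector φ‖ ^ 2 = 1 := by exact_mod_cast h.symm
  exact (pow_eq_one_iff_of_nonneg (norm_nonneg _) two_ne_zero).1 h2

/-- Nondegeneracy: as `φ` has norm `1` on `A`, some `a` in the unit ball has `|φ a|` near `1`. With
`w = a v` one gets `‖v - a* w‖² ≤ 1 - ‖w‖²`, so `a* a v` is close to `v`. -/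
lemma stateVector_mem_closure (φ : StateSpace A) :
    stateVector φ ∈ closure (Set.range fun a : A => universalRep (incl a) (stateVector φ)) := by
  set v := stateVector φ with hv
  have hv1 : ‖v‖ = 1 := norm_stateVector φ
  refine Metric.mem_closure_iff.2 fun ε hε => ?_
  obtain ⟨δ, hδ, hδε⟩ : ∃ δ > 0, 2 * δ < ε ^ 2 :=
    ⟨ε ^ 2 / 4, by positivity, by linarith [pow_pos hε 2]⟩
  obtain ⟨_, ⟨a, ha, rfl⟩, hlt, -⟩ := φ.2.2.exists_between (sub_lt_self 1 hδ)
  rw [mem_closedBall_zero_iff] at ha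
  set w := universalRep (incl a) v with hw
  have hφa : ‖φ.1 (incl a)‖ ≤ ‖w‖ := by
    calc ‖φ.1 (incl a)‖ = ‖⟪v, w⟫_ℂ‖ := by
          rw [hw, ← vectorFunctional_apply, vectorFunctional_stateVector]; rfl
      _ ≤ ‖v‖ * ‖w‖ := norm_inner_le_norm _ _
      _ = ‖w‖ := by rw [hv1, one_mul]
  refine ⟨_, ⟨star a * a, rfl⟩, ?_⟩
  have h1 : universalRep (incl (star a * a)) v = universalRep (star (incl a)) w := by
    rw [map_mul, map_star, universalRep_mul_apply]
  have h2 : ‖universalRep (star (incl a)) w‖ ≤ ‖w‖ := by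
    refine (norm_universalRep_apply_le _ _).trans ?_
    rw [norm_star, show ‖incl a‖ = ‖a‖ from norm_coeHom a]
    exact mul_le_of_le_one_left (norm_nonneg _) ha
  have h3 : ‖v - universalRep (star (incl a)) w‖ ^ 2 ≤ 1 - ‖w‖ ^ 2 := by
    have h4 : RCLike.re ⟪v, universalRep (star (incl a)) w⟫_ℂ = ‖w‖ ^ 2 := by
      rw [inner_universalRep_star, ← hw, inner_self_eq_norm_sq]
    rw [@norm_sub_sq ℂ, h4, hv1]
    have := pow_le_pow_left₀ (norm_nonneg _) h2 2
    linarith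
  change dist v (universalRep (incl (star a * a)) v) < ε
  rw [dist_eq_norm, h1]
  refine lt_of_pow_lt_pow_left₀ 2 hε.le (h3.trans_lt ?_)
  have h5 : 1 - δ < ‖w‖ := hlt.trans_le hφa
  nlinarith [norm_nonneg w]

variable {M : NonUnitalStarSubalgebra ℂ A} (K : TopologicalSpace.Compacts (Spec M))

lemma indicator_mem (v : UniversalSpace A) : indicator M K v ∈ supportedOn M K :=
  Submodule.starProjection_apply_mem _ _

lemma indicator_eq_self {v : UniversalSpace A} (hv : v ∈ supportedOn M K) :
    indicator M K v = v :=
  Submodule.starProjection_eq_self_iff.2 hv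

lemma indicator_indicator (v : UniversalSpace A) :
    indicator M K (indicator M K v) = indicator M K v :=
  indicator_eq_self K (indicator_mem K v)

lemma inner_indicator (v w : UniversalSpace A) :
    ⟪indicator M K v, w⟫_ℂ = ⟪v, indicator M K w⟫_ℂ :=
  Submodule.inner_starProjection_left_eq_right _ _ _

/-- The component of the vector of a state that is orthogonal to the range of `χ_K`. -/
def outerVector (φ : StateSpace A) : UniversalSpace A :=
  stateVector φ - indicator M K (stateVector φ)

lemma outerVector_eq_zero {K : TopologicalSpace.Compacts (Spec M)} {φ : StateSpace A}
    (hφ : φ ∈ localStates M K) :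
    outerVector K φ = 0 := by
  have h : ⟪stateVector φ, indicator M K (stateVector φ)⟫_ℂ = 1 := hφ
  have h0 : ⟪outerVector K φ, outerVector K φ⟫_ℂ = 0 := by
    rw [outerVector, inner_sub_left, inner_sub_right, inner_sub_right, inner_indicator,
      inner_indicator, indicator_indicator, h, inner_self_eq_norm_sq_to_K, norm_stateVector]
    simp
  exact inner_self_eq_zero.1 h0

end VectorFunctional

/-! ### States of `C₀(X)` and compact subsets of the spectrum -/

section CompactSupport

variable {X : Type u} [MetricSpace X] [LocallyCompactSpace X]

lemma norm_vectorFunctional_le (v : UniversalSpace C₀(X, ℂ)) {u w : UA C₀(X, ℂ)}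
    (hu : IsSelfAdjoint u) (hw : IsSelfAdjoint w) (h : ∀ x, ‖ev x u‖ ≤ (ev x w).re) :
    ‖vectorFunctional v u‖ ≤ (vectorFunctional v w).re := by
  rw [isSelfAdjoint_iff_ev] at hu hw
  have key (x : X) : |(ev x u).re| ≤ (ev x w).re := by
    have := h x
    rwa [← hu, Complex.norm_real] at this
  have h1 : 0 ≤ vectorFunctional v (w - u) := vectorFunctional_nonneg v (nonneg_of_ev fun x => by
    rw [map_sub, ← hu, ← hw, ← Complex.ofReal_sub]
    exact_mod_cast sub_nonneg.2 (abs_le.1 (key x)).2)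
  have h2 : 0 ≤ vectorFunctional v (w + u) := vectorFunctional_nonneg v (nonneg_of_ev fun x => by
    rw [map_add, ← hu, ← hw, ← Complex.ofReal_add]
    exact_mod_cast neg_le_iff_add_nonneg.1 (neg_le.1 (abs_le.1 (key x)).1))
  rw [map_sub, Complex.nonneg_iff, Complex.sub_re, Complex.sub_im] at h1
  rw [map_add, Complex.nonneg_iff, Complex.add_re, Complex.add_im] at h2
  have h3 : vectorFunctional v u = ((vectorFunctional v u).re : ℂ) := by
    apply Complex.ext <;> simp
    linarith
  rw [h3, Complex.norm_real, Real.norm_eq_abs, abs_le]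
  constructor <;> linarith

variable (K : TopologicalSpace.Compacts (Spec (⊤ : NonUnitalStarSubalgebra ℂ C₀(X, ℂ))))

/-- `χ_K` lies in the double commutant of `M`, and by commutativity `u` acts in the commutant. -/
lemma indicator_universalRep (u : UA C₀(X, ℂ)) (v : UniversalSpace C₀(X, ℂ)) :
    indicator ⊤ K (universalRep u v) = universalRep u (indicator ⊤ K v) := by
  have h := indicator_mem_doubleCommutant (⊤ : NonUnitalStarSubalgebra ℂ C₀(X, ℂ)) K
    (universalRep u) (by
      rintro _ ⟨f, rfl⟩
      rw [← map_mul, UA.mul_comm, map_mul])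
  exact (congrArg (fun T => T v) h).symm

variable {K}

/-- The range of `χ_K` is defined by elements of `A` only. For `u` in `𝔲A` one tests on the vectors
`a v`, which approximate `v`: there `u a` belongs to `A` and vanishes on `K`. -/
lemma universalRep_indicator_eq_zero (φ : StateSpace C₀(X, ℂ)) {u : UA C₀(X, ℂ)}
    (hu : ∀ x ∈ pointSet K, ev x u = 0) :
    universalRep u (indicator ⊤ K (stateVector φ)) = 0 := by
  have hcl : IsClosed {w | universalRep u (indicator ⊤ K w) = 0} :=
    isClosed_eq ((universalRep u).continuous.comp (indicator ⊤ K).continuous) continuous_const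
  refine hcl.closure_subset_iff.2 ?_ (stateVector_mem_closure φ)
  rintro _ ⟨a, rfl⟩
  change universalRep u (indicator ⊤ K (universalRep (incl a) (stateVector φ))) = 0
  rw [indicator_universalRep, ← universalRep_mul_apply]
  obtain ⟨b, c, hbc⟩ := u.exists_eq
  have hb : u * incl a = incl (b * a + c • a) := ext_ev fun x => by
    rw [hbc, map_mul, map_add, ev_incl, ev_algebraMap, ev_incl, ev_incl]
    simp [add_mul]
  rw [hb]
  refine mem_supportedOn.1 (indicator_mem K _) ⟨_, trivial⟩ (forall_mem_apply_eq_zero.2 ?_)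
  intro x hx
  change (b * a + c • a) x = 0
  rw [← ev_incl, ← hb, map_mul, hu x hx, zero_mul]

lemma universalRep_incl_indicator {b : C₀(X, ℂ)} (hb : ∀ x ∉ pointSet K, b x = 0)
    (v : UniversalSpace C₀(X, ℂ)) :
    universalRep (incl b) (indicator ⊤ K v) = universalRep (incl b) v := by
  rw [← indicator_universalRep]
  refine indicator_eq_self K (mem_supportedOn.2 fun f hf => ?_)
  rw [← universalRep_mul_apply]
  have : incl (f : C₀(X, ℂ)) * incl b = 0 := ext_ev fun x => by
    rw [map_mul, ev_incl, ev_incl, map_zero]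
    by_cases hx : x ∈ pointSet K
    · rw [forall_mem_apply_eq_zero.1 hf x hx, zero_mul]
    · rw [hb x hx, mul_zero]
  rw [this, map_zero, zero_apply]

lemma inner_universalRep_outerVector (φ : StateSpace C₀(X, ℂ)) (u : UA C₀(X, ℂ)) :
    ⟪stateVector φ, universalRep u (outerVector K φ)⟫_ℂ =
      vectorFunctional (outerVector K φ) u := by
  rw [vectorFunctional_apply]
  conv_rhs => rw [outerVector, inner_sub_left]
  rw [inner_indicator, indicator_universalRep, outerVector, map_sub (indicator ⊤ K),
    indicator_indicator, sub_self, map_zero, inner_zero_right, sub_zero]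

/-- This turns the quantity in the definition of tameness into a positive functional of `u`, to
which pointwise estimates apply. -/
lemma normalExtension_sub_indicator (φ : StateSpace C₀(X, ℂ)) (u : UA C₀(X, ℂ)) :
    φ.normalExtension (universalRep u - indicator ⊤ K * universalRep u * indicator ⊤ K) =
      vectorFunctional (outerVector K φ) u := by
  rw [← inner_universalRep_outerVector, outerVector, map_sub]
  change ⟪stateVector φ, universalRep u (stateVector φ) -
    indicator ⊤ K (universalRep u (indicator ⊤ K (stateVector φ)))⟫_ℂ = _
  rw [indicator_universalRep, indicator_indicator]

lemma eval_eq_vectorFunctional_outerVector (φ : StateSpace C₀(X, ℂ)) {u : UA C₀(X, ℂ)}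
    (hu : ∀ x ∈ pointSet K, ev x u = 0) :
    φ.eval u = vectorFunctional (outerVector K φ) u := by
  rw [← inner_universalRep_outerVector, outerVector, map_sub, universalRep_indicator_eq_zero φ hu,
    sub_zero, ← vectorFunctional_stateVector]
  rfl

lemma vectorFunctional_outerVector_incl (φ : StateSpace C₀(X, ℂ)) {b : C₀(X, ℂ)}
    (hb : ∀ x ∉ pointSet K, b x = 0) :
    vectorFunctional (outerVector K φ) (incl b) = 0 := by
  rw [vectorFunctional_apply]
  conv_lhs => rw [outerVector, map_sub, universalRep_incl_indicator hb, sub_self, inner_zero_right]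

lemma eval_eq_zero_of_mem_localStates {φ : StateSpace C₀(X, ℂ)} (hφ : φ ∈ localStates ⊤ K)
    {u : UA C₀(X, ℂ)} (hu : ∀ x ∈ pointSet K, ev x u = 0) : φ.eval u = 0 := by
  rw [eval_eq_vectorFunctional_outerVector φ hu, outerVector_eq_zero hφ, vectorFunctional_apply,
    inner_zero_left]

lemma norm_eval_le_of_mem_localStates {φ : StateSpace C₀(X, ℂ)} (hφ : φ ∈ localStates ⊤ K)
    {u : UA C₀(X, ℂ)} (hu : IsSelfAdjoint u) {C : ℝ} (hC : ∀ x ∈ pointSet K, ‖ev x u‖ ≤ C) :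
    ‖φ.eval u‖ ≤ C := by
  set s : UA C₀(X, ℂ) := CFC.abs u - C • (1 : UA C₀(X, ℂ)) with hs
  have hsx (x : X) : ev x s = ((‖ev x u‖ - C : ℝ) : ℂ) := by
    rw [hs, map_sub, ev_abs, ev_real_smul, map_one, mul_one, Complex.ofReal_sub]
  -- The positive part of `|u| - C`: it vanishes on `pointSet K`, so `φ` kills it, and `|u| ≤ b + C`
  -- everywhere.
  set b : UA C₀(X, ℂ) := (1 / 2 : ℝ) • (CFC.abs s + s) with hb
  have hbx (x : X) : ev x b = ((1 / 2 * (|‖ev x u‖ - C| + (‖ev x u‖ - C)) : ℝ) : ℂ) := by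
    rw [hb, ev_real_smul, map_add, ev_abs, hsx, Complex.norm_real, Real.norm_eq_abs]
    push_cast
    rfl
  have hb0 : φ.eval b = 0 := eval_eq_zero_of_mem_localStates hφ fun x hx => by
    rw [hbx, abs_of_nonpos (by linarith [hC x hx])]
    simp
  set w : UA C₀(X, ℂ) := b + C • (1 : UA C₀(X, ℂ)) with hw
  have hwx (x : X) : ev x w = ((1 / 2 * (|‖ev x u‖ - C| + (‖ev x u‖ - C)) + C : ℝ) : ℂ) := by
    rw [hw, map_add, hbx, ev_real_smul, map_one, mul_one, Complex.ofReal_add]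
  have h := norm_vectorFunctional_le (stateVector φ) hu (w := w)
    (isSelfAdjoint_iff_ev.2 fun x => by rw [hwx, Complex.ofReal_re]) fun x => by
      rw [hwx, Complex.ofReal_re]
      linarith [le_abs_self (‖ev x u‖ - C)]
  have hφw : φ.eval w = C := by
    change φ.1 w = C
    rw [hw, map_add]
    change φ.eval b + φ.1 ((C : ℂ) • (1 : UA C₀(X, ℂ))) = C
    rw [hb0, map_smul, φ.2.1]
    simp
  rwa [vectorFunctional_stateVector, vectorFunctional_stateVector, hφw, Complex.ofReal_re] at h

lemma pointSet_nonempty_of_mem_localStates {φ : StateSpace C₀(X, ℂ)}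
    (hφ : φ ∈ localStates ⊤ K) : (pointSet K).Nonempty := by
  by_contra! h
  have := norm_eval_le_of_mem_localStates hφ (IsSelfAdjoint.one _) (C := 0) (by simp [h])
  rw [StateSpace.eval, φ.2.1, norm_one] at this
  linarith

end CompactSupport

/-! ### Total boundedness of Lipschitz functions on compact sets -/

/-- Arzelà–Ascoli by hand: restriction to a finite `ε`-net of `K` gives a bounded set in a finite
dimensional space. The `3 ε` is one `ε` at the net point and one for each of the two functions
moving to it. -/
lemma exists_finite_net_of_lipschitz {X ι : Type*} [PseudoMetricSpace X] {S : Set ι}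
    {g : ι → X → ℂ} (hg : ∀ i ∈ S, ∀ x y, ‖g i x - g i y‖ ≤ dist x y) {x₀ : X} {B : ℝ}
    (hB : ∀ i ∈ S, ‖g i x₀‖ ≤ B) {K : Set X} (hK : IsCompact K) {ε : ℝ} (hε : 0 < ε) :
    ∃ F ⊆ S, F.Finite ∧ ∀ i ∈ S, ∃ j ∈ F, ∀ x ∈ K, ‖g i x - g j x‖ ≤ 3 * ε := by
  obtain ⟨t, -, ht, hcover⟩ := hK.finite_cover_balls hε
  have : Fintype t := ht.fintype
  let T : ι → (t → ℂ) := fun i x => g i x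
  have hT : Bornology.IsBounded (T '' S) := by
    rw [Bornology.forall_isBounded_image_eval_iff.symm]
    intro x
    refine isBounded_iff_forall_norm_le.2 ⟨B + dist (x : X) x₀, ?_⟩
    rintro _ ⟨_, ⟨i, hi, rfl⟩, rfl⟩
    change ‖g i x‖ ≤ _
    calc ‖g i x‖ = ‖g i x₀ + (g i x - g i x₀)‖ := by rw [add_sub_cancel]
      _ ≤ ‖g i x₀‖ + ‖g i x - g i x₀‖ := norm_add_le _ _
      _ ≤ B + dist (x : X) x₀ := add_le_add (hB i hi) (hg i hi _ _)
  obtain ⟨F, hFS, hF, hcoverT⟩ := Set.exists_subset_image_finite_and.1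
    (Metric.finite_approx_of_totallyBounded
      (hT.isCompact_closure.totallyBounded.subset subset_closure) ε hε)
  refine ⟨F, hFS, hF, fun i hi => ?_⟩
  obtain ⟨_, ⟨j, hj, rfl⟩, hij⟩ := Set.mem_iUnion₂.1 (hcoverT ⟨i, hi, rfl⟩)
  refine ⟨j, hj, fun x hx => ?_⟩
  obtain ⟨y, hy, hxy⟩ := Set.mem_iUnion₂.1 (hcover hx)
  have h1 : ‖g i y - g j y‖ ≤ ε := by
    rw [← dist_eq_norm]
    exact (dist_le_pi_dist (T i) (T j) ⟨y, hy⟩).trans (Metric.mem_ball.1 hij).le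
  have hxy' : dist x y ≤ ε := (Metric.mem_ball.1 hxy).le
  have h2 := (hg i hi x y).trans hxy'
  have h3 := (hg j (hFS hj) y x).trans ((dist_comm y x).trans_le hxy')
  calc ‖g i x - g j x‖ = ‖(g i x - g i y) + (g i y - g j y) + (g j y - g j x)‖ := by congr 1; abel
    _ ≤ ‖g i x - g i y‖ + ‖g i y - g j y‖ + ‖g j y - g j x‖ := norm_add₃_le
    _ ≤ 3 * ε := by linarith

/-! ### States -/

section States

variable {A : Type u} [NonUnitalCStarAlgebra A]

lemma norm_eval_le (φ : StateSpace A) (u : UA A) : ‖φ.eval u‖ ≤ ‖u‖ := by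
  rw [← vectorFunctional_stateVector, vectorFunctional_apply]
  refine (norm_inner_le_norm _ _).trans ?_
  have h := norm_universalRep_apply_le u (stateVector φ)
  rw [norm_stateVector, mul_one] at h
  rwa [norm_stateVector, one_mul]

lemma StateSpace.eval_add (φ : StateSpace A) (u w : UA A) :
    φ.eval (u + w) = φ.eval u + φ.eval w := map_add φ.1 u w

lemma StateSpace.eval_sub (φ : StateSpace A) (u w : UA A) :
    φ.eval (u - w) = φ.eval u - φ.eval w := map_sub φ.1 u w

lemma StateSpace.eval_smul (φ : StateSpace A) (c : ℂ) (u : UA A) :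
    φ.eval (c • u) = c * φ.eval u := map_smul φ.1 c u

lemma StateSpace.eval_real_smul (φ : StateSpace A) (t : ℝ) (u : UA A) :
    φ.eval (t • u) = t * φ.eval u := φ.eval_smul t u

lemma StateSpace.eval_one (φ : StateSpace A) : φ.eval 1 = 1 := φ.2.1

lemma StateSpace.eval_sub_smul_one (φ : StateSpace A) (u : UA A) (t : ℝ) :
    φ.eval (u - t • 1) = φ.eval u - t := by
  rw [eval_sub, eval_real_smul, eval_one, mul_one]

lemma StateSpace.eval_re (φ : StateSpace A) {u : UA A} (hu : IsSelfAdjoint u) :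
    ((φ.eval u).re : ℂ) = φ.eval u := by
  rw [← Complex.conj_eq_iff_re, ← vectorFunctional_stateVector, vectorFunctional_apply,
    inner_conj_symm, ← inner_universalRep_star, hu.star_eq]

lemma edist_mongeKantorovich_le_iff {L : UA A → ℝ≥0∞} {φ ψ : StateSpace A} {C : ℝ≥0∞} :
    (mongeKantorovich L).edist φ ψ ≤ C ↔ ∀ a : A, IsSelfAdjoint a → L (incl a) ≤ 1 →
      edist (φ.eval (incl a)) (ψ.eval (incl a)) ≤ C := by
  change (⨆ (a : A) (_ : IsSelfAdjoint a) (_ : L (incl a) ≤ 1),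
    edist (φ.eval (incl a)) (ψ.eval (incl a))) ≤ C ↔ _
  simp only [iSup_le_iff]

lemma isSelfAdjoint_sub_smul_one {u : UA A} (hu : IsSelfAdjoint u) (t : ℝ) :
    IsSelfAdjoint (u - t • (1 : UA A)) :=
  hu.sub ((IsSelfAdjoint.all t).smul (.one _))

end States

/-! ### Regularity: states local to a compact set are at finite distance -/

section Main

variable {X : Type u} [MetricSpace X] [LocallyCompactSpace X]

lemma ev_sub_smul_one (x : X) (u : UA C₀(X, ℂ)) (t : ℝ) :
    ev x (u - t • (1 : UA C₀(X, ℂ))) = ev x u - t := by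
  rw [map_sub, ev_real_smul, map_one, mul_one]

lemma unitalExtension_le_one_iff {u : UA C₀(X, ℂ)} (hu : IsSelfAdjoint u) :
    unitalExtension lipSeminorm u ≤ 1 ↔ ∀ x y, ‖ev x u - ev y u‖ ≤ dist x y := by
  rw [unitalExtension_eq hu, lipConst_le_one_iff]

variable {K : TopologicalSpace.Compacts (Spec (⊤ : NonUnitalStarSubalgebra ℂ C₀(X, ℂ)))}

lemma norm_eval_sub_ev_le {φ : StateSpace C₀(X, ℂ)} (hφ : φ ∈ localStates ⊤ K)
    {u : UA C₀(X, ℂ)} (hu : IsSelfAdjoint u) (hL : unitalExtension lipSeminorm u ≤ 1)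
    {x : X} (hx : x ∈ pointSet K) :
    ‖φ.eval u - ev x u‖ ≤ Metric.diam (pointSet K) := by
  have h := norm_eval_le_of_mem_localStates hφ (isSelfAdjoint_sub_smul_one hu (ev x u).re)
    (C := Metric.diam (pointSet K)) fun y hy => by
      rw [ev_sub_smul_one, isSelfAdjoint_iff_ev.1 hu]
      exact ((unitalExtension_le_one_iff hu).1 hL y x).trans
        (Metric.dist_le_diam_of_mem (isCompact_pointSet K).isBounded hy hx)
  rwa [StateSpace.eval_sub_smul_one, isSelfAdjoint_iff_ev.1 hu] at h

lemma ediam_localStates_lt_top :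
    letI := mongeKantorovich (unitalExtension (lipSeminorm (X := X)))
    Metric.ediam (localStates ⊤ K) < ∞ := by
  let _ := mongeKantorovich (unitalExtension (lipSeminorm (X := X)))
  refine lt_of_le_of_lt (Metric.ediam_le (d := ENNReal.ofReal (2 * Metric.diam (pointSet K)))
    fun φ hφ ψ hψ => ?_) ENNReal.ofReal_lt_top
  refine edist_mongeKantorovich_le_iff.2 fun a ha hL => ?_
  obtain ⟨x, hx⟩ := pointSet_nonempty_of_mem_localStates hφ
  have ha' := isSelfAdjoint_incl_iff.2 ha
  rw [edist_dist]
  refine ENNReal.ofReal_le_ofReal ?_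
  refine (dist_triangle_right _ _ (ev x (incl a))).trans ?_
  rw [dist_eq_norm, dist_eq_norm, two_mul]
  exact add_le_add (norm_eval_sub_ev_le hφ ha' hL hx) (norm_eval_sub_ev_le hψ ha' hL hx)

/-! ### The Monge-Kantorovich topology is finer than the weak* topology -/

lemma edist_eval_le_mul {b : C₀(X, ℂ)} (hb : IsSelfAdjoint b) {n : ℝ} (hn : 0 < n)
    (hL : lipSeminorm b ≤ ENNReal.ofReal n) (φ ψ : StateSpace C₀(X, ℂ)) :
    edist (φ.eval (incl b)) (ψ.eval (incl b)) ≤ ENNReal.ofReal n *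
      (mongeKantorovich (unitalExtension (lipSeminorm (X := X)))).edist φ ψ := by
  have hsa : IsSelfAdjoint (n⁻¹ • b) := (IsSelfAdjoint.all n⁻¹).smul hb
  have h := edist_mongeKantorovich_le_iff.1 (le_refl
    ((mongeKantorovich (unitalExtension (lipSeminorm (X := X)))).edist φ ψ)) (n⁻¹ • b) hsa (by
      rw [unitalExtension_incl hsa]
      change lipConst (n⁻¹ • ⇑b) ≤ 1
      rw [lipConst_smul]
      calc ‖n⁻¹‖ₑ * lipConst b ≤ ‖n⁻¹‖ₑ * ENNReal.ofReal n := by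
            gcongr
            exact hL
        _ = 1 := by
          rw [Real.enorm_of_nonneg (inv_nonneg.2 hn.le), ← ENNReal.ofReal_mul (by positivity),
            inv_mul_cancel₀ hn.ne', ENNReal.ofReal_one])
  have hin : incl b = n • incl (n⁻¹ • b) := ext_ev fun x => by
    rw [ev_real_smul, ev_incl, ev_incl]
    change b x = n * (n⁻¹ • b x)
    rw [Complex.real_smul, ← mul_assoc, ← Complex.ofReal_mul, mul_inv_cancel₀ hn.ne',
      Complex.ofReal_one, one_mul]
  rw [hin, StateSpace.eval_real_smul, StateSpace.eval_real_smul, ← smul_eq_mul, ← smul_eq_mul,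
    edist_smul₀, ENNReal.smul_def, ← enorm_eq_nnnorm, ← ofReal_norm, Complex.norm_real,
    Real.norm_of_nonneg hn.le]
  exact mul_le_mul_right h _

lemma continuous_eval_mongeKantorovich_of_isSelfAdjoint {a : C₀(X, ℂ)} (ha : IsSelfAdjoint a) :
    @Continuous _ _ (mongeKantorovich
      (unitalExtension (lipSeminorm (X := X)))).toUniformSpace.toTopologicalSpace _
      fun φ : StateSpace C₀(X, ℂ) => φ.eval (incl a) := by
  let _ := mongeKantorovich (unitalExtension (lipSeminorm (X := X)))
  rw [continuous_iff_continuousAt]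
  refine fun ψ => Metric.tendsto_nhds.2 fun ε hε => ?_
  obtain ⟨b, hb, hlt, hab⟩ := exists_lipschitz_approx ha (show 0 < ε / 4 by positivity)
  set n := (lipSeminorm b).toReal + 1 with hn
  have hn0 : 0 < n := by positivity
  have hbn : lipSeminorm b ≤ ENNReal.ofReal n := by
    rw [← ENNReal.ofReal_toReal hlt.ne]
    exact ENNReal.ofReal_le_ofReal (by linarith)
  filter_upwards [Metric.eball_mem_nhds ψ (ε := ENNReal.ofReal (ε / (4 * n)))
    (ENNReal.ofReal_pos.2 (by positivity))] with φ hφ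
  have h1 : dist (φ.eval (incl b)) (ψ.eval (incl b)) ≤ ε / 4 := by
    have h := (edist_eval_le_mul hb hn0 hbn φ ψ).trans
      (mul_le_mul_right (Metric.mem_eball.1 hφ).le _)
    rw [← ENNReal.ofReal_mul hn0.le, edist_dist, ENNReal.ofReal_le_ofReal_iff (by positivity)] at h
    calc _ ≤ n * (ε / (4 * n)) := h
      _ = ε / 4 := by field_simp
  have h2 (ω : StateSpace C₀(X, ℂ)) : dist (ω.eval (incl a)) (ω.eval (incl b)) ≤ ε / 4 := by
    rw [dist_eq_norm, ← ω.eval_sub, ← map_sub]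
    exact (norm_eval_le _ _).trans ((norm_incl _).trans_le hab)
  have h3 := dist_triangle4 (φ.eval (incl a)) (φ.eval (incl b)) (ψ.eval (incl b)) (ψ.eval (incl a))
  have h4 := h2 φ
  have h5 := h2 ψ
  rw [dist_comm] at h5
  linarith

lemma mongeKantorovich_le_weakStar :
    (mongeKantorovich (unitalExtension (lipSeminorm (X := X)))).toUniformSpace.toTopologicalSpace ≤
      weakStar C₀(X, ℂ) := by
  let _ := mongeKantorovich (unitalExtension (lipSeminorm (X := X)))
  refine continuous_iff_le_induced.1 (continuous_pi fun a => ?_)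
  have h : (fun φ : StateSpace C₀(X, ℂ) => φ.eval (incl a)) = fun φ =>
      φ.eval (incl (realPart a : C₀(X, ℂ))) +
        Complex.I * φ.eval (incl (imaginaryPart a : C₀(X, ℂ))) := by
    ext φ
    rw [← φ.eval_smul, ← φ.eval_add, ← map_smul, ← map_add, realPart_add_I_smul_imaginaryPart]
  rw [h]
  exact (continuous_eval_mongeKantorovich_of_isSelfAdjoint (realPart a).2).add
    (continuous_const.mul
      (continuous_eval_mongeKantorovich_of_isSelfAdjoint (imaginaryPart a).2))

end Main

/-! ### Tame sets of states -/

lemma continuous_weakStar_eval {A : Type u} [NonUnitalCStarAlgebra A] (a : A) :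
    @Continuous _ _ (weakStar A) _ fun φ : StateSpace A => φ.eval (incl a) := by
  let _ := weakStar A
  have h : Continuous fun (φ : StateSpace A) (b : A) => φ.eval (incl b) :=
    continuous_induced_dom
  exact continuous_pi_iff.1 h a

section Tame

variable {X : Type u} [MetricSpace X] [LocallyCompactSpace X]
  {K : TopologicalSpace.Compacts (Spec (⊤ : NonUnitalStarSubalgebra ℂ C₀(X, ℂ)))}

lemma norm_ev_le_of_mem_lipschitzBall {μ : StateSpace C₀(X, ℂ)} (hμ : μ ∈ localStates ⊤ K)
    {u : UA C₀(X, ℂ)} (hu : u ∈ lipschitzBall (unitalExtension lipSeminorm) μ)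
    {x : X} (hx : x ∈ pointSet K) : ‖ev x u‖ ≤ Metric.diam (pointSet K) := by
  have h := norm_eval_sub_ev_le hμ hu.1 hu.2.1 hx
  rwa [hu.2.2, zero_sub, norm_neg] at h

lemma isSelfAdjoint_abs (u : UA C₀(X, ℂ)) : IsSelfAdjoint (CFC.abs u) :=
  isSelfAdjoint_iff_ev.2 fun x => by rw [ev_abs, Complex.ofReal_re]

lemma norm_eval_abs_le {μ : StateSpace C₀(X, ℂ)} (hμ : μ ∈ localStates ⊤ K)
    {u : UA C₀(X, ℂ)} (hu : u ∈ lipschitzBall (unitalExtension lipSeminorm) μ) :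
    ‖μ.eval (CFC.abs u)‖ ≤ Metric.diam (pointSet K) :=
  norm_eval_le_of_mem_localStates hμ (isSelfAdjoint_abs u) fun x hx => by
    rw [ev_abs, Complex.norm_real, norm_norm]
    exact norm_ev_le_of_mem_lipschitzBall hμ hu hx

lemma abs_sub_smul_one_mem_lipschitzBall (μ : StateSpace C₀(X, ℂ))
    {u : UA C₀(X, ℂ)} (hu : u ∈ lipschitzBall (unitalExtension lipSeminorm) μ) :
    CFC.abs u - (μ.eval (CFC.abs u)).re • (1 : UA C₀(X, ℂ)) ∈
      lipschitzBall (unitalExtension lipSeminorm) μ := by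
  have hs := isSelfAdjoint_sub_smul_one (isSelfAdjoint_abs u) (μ.eval (CFC.abs u)).re
  refine ⟨hs, (unitalExtension_le_one_iff hs).2 fun x y => ?_, ?_⟩
  · rw [ev_sub_smul_one, ev_sub_smul_one, sub_sub_sub_cancel_right, ev_abs, ev_abs,
      ← Complex.ofReal_sub, Complex.norm_real]
    exact (abs_norm_sub_norm_le _ _).trans ((unitalExtension_le_one_iff hu.1).1 hu.2.1 x y)
  · rw [StateSpace.eval_sub_smul_one, StateSpace.eval_re _ (isSelfAdjoint_abs u), sub_self]

/-- On a tame set of states, the absolute values of the elements of the Lipschitz ball are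
uniformly small outside some compact set. -/
lemma exists_vectorFunctional_outerVector_abs_le {μ : StateSpace C₀(X, ℂ)}
    (hμ : μ ∈ localStates ⊤ K) {𝒦 : Set (StateSpace C₀(X, ℂ))}
    (ht : Filter.Tendsto
      (fun K : TopologicalSpace.Compacts (Spec (⊤ : NonUnitalStarSubalgebra ℂ C₀(X, ℂ))) =>
        ⨆ (a : UA C₀(X, ℂ)) (_ : a ∈ lipschitzBall (unitalExtension lipSeminorm) μ)
          (φ : StateSpace C₀(X, ℂ)) (_ : φ ∈ 𝒦),
          ‖φ.normalExtension
            (universalRep a - indicator ⊤ K * universalRep a * indicator ⊤ K)‖ₑ)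
      Filter.atTop (𝓝 0)) {ε : ℝ} (hε : 0 < ε) :
    ∃ K' : TopologicalSpace.Compacts (Spec (⊤ : NonUnitalStarSubalgebra ℂ C₀(X, ℂ))),
      ∀ ψ ∈ 𝒦, ∀ u ∈ lipschitzBall (unitalExtension lipSeminorm) μ,
        (vectorFunctional (outerVector K' ψ) (CFC.abs u)).re ≤ ε := by
  set D := Metric.diam (pointSet K) with hD
  have hD0 : 0 ≤ D := Metric.diam_nonneg
  obtain ⟨r, hr, K₁, hK₁, f, e, hef, -, -, hf1, hf0, hfl⟩ :=
    exists_lipschitz_bump (isCompact_pointSet K)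
  -- The final estimate is `η + (D / r) η`: tameness for `|u| - μ(|u|)`, plus `μ(|u|) ≤ D` times an
  -- outer mass at most `η / r`.
  set η := ε / (1 + D / r) with hη
  have hη0 : 0 < η := by positivity
  let K₂ : TopologicalSpace.Compacts (Spec (⊤ : NonUnitalStarSubalgebra ℂ C₀(X, ℂ))) :=
    ⟨evalChar '' K₁, hK₁.image continuous_evalChar⟩
  -- `K'` is taken above `K₂` so that the bump `e` vanishes off `pointSet K'` and the outer part of
  -- a state does not see it.
  obtain ⟨K', hlt, hle⟩ := ((ht.eventually_lt_const (ENNReal.ofReal_pos.2 hη0)).and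
    (Filter.eventually_ge_atTop K₂)).exists
  have hball {ψ : StateSpace C₀(X, ℂ)} (hψ : ψ ∈ 𝒦) {u : UA C₀(X, ℂ)}
      (hu : u ∈ lipschitzBall (unitalExtension lipSeminorm) μ) :
      ‖vectorFunctional (outerVector K' ψ) u‖ ≤ η := by
    rw [← normalExtension_sub_indicator, ← ENNReal.ofReal_le_ofReal_iff hη0.le, ofReal_norm]
    refine le_trans ?_ hlt.le
    exact le_iSup₂_of_le u hu (le_iSup₂_of_le ψ hψ le_rfl)
  refine ⟨K', fun ψ hψ u hu => ?_⟩
  set V := vectorFunctional (outerVector K' ψ) with hV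
  set m := ‖outerVector K' ψ‖ ^ 2 with hm
  have hV1 (t : ℝ) (w : UA C₀(X, ℂ)) : V (w - t • 1) = V w - ((t * m : ℝ) : ℂ) := by
    rw [map_sub, Complex.ofReal_mul, ← vectorFunctional_one]
    congr 1
    exact V.map_smul (t : ℂ) 1
  have hm0 : 0 ≤ m := sq_nonneg _
  -- Test element `r (e - 1)`: it is `1`-Lipschitz, vanishes on the support of `μ`, and its outer
  -- integral is `-r m`.
  have hrm : r * m ≤ η := by
    have hre : IsSelfAdjoint (r • incl e) := (IsSelfAdjoint.all r).smul
      (isSelfAdjoint_incl_iff.2 (isSelfAdjoint_iff_apply.2 fun x => by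
        rw [hef, Complex.ofReal_re]))
    have hmem : r • incl e - r • 1 ∈ lipschitzBall (unitalExtension lipSeminorm) μ := by
      have hs := isSelfAdjoint_sub_smul_one hre r
      refine ⟨hs, (unitalExtension_le_one_iff hs).2 fun x y => ?_, ?_⟩
      · rw [ev_sub_smul_one, ev_sub_smul_one, sub_sub_sub_cancel_right, ev_real_smul,
          ev_real_smul, ev_incl, ev_incl, hef, hef, ← mul_sub, ← Complex.ofReal_sub,
          ← Complex.ofReal_mul, Complex.norm_real, Real.norm_eq_abs, abs_mul, abs_of_pos hr]
        calc r * |f x - f y| ≤ r * (dist x y / r) := by gcongr; exact hfl x y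
          _ = dist x y := by field_simp
      · refine eval_eq_zero_of_mem_localStates hμ fun x hx => ?_
        rw [ev_sub_smul_one, ev_real_smul, ev_incl, hef, hf1 x hx, Complex.ofReal_one, mul_one,
          sub_self]
    have h := hball hψ hmem
    have h0 : V (r • incl e) = 0 := by
      have : V (incl e) = 0 := vectorFunctional_outerVector_incl ψ fun x hx => by
        rw [hef, hf0 x fun hx1 => hx (hle ⟨x, hx1, rfl⟩), Complex.ofReal_zero]
      calc V (r • incl e) = (r : ℂ) • V (incl e) := V.map_smul (r : ℂ) _
        _ = 0 := by rw [this, smul_zero]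
    rw [← hV, hV1, h0, zero_sub, norm_neg, Complex.norm_real] at h
    exact (le_abs_self _).trans h
  have h := hball hψ (abs_sub_smul_one_mem_lipschitzBall μ hu)
  rw [← hV, hV1] at h
  have h1 := (Complex.re_le_norm _).trans h
  rw [Complex.sub_re, Complex.ofReal_re] at h1
  have h2 : (μ.eval (CFC.abs u)).re ≤ D := (Complex.re_le_norm _).trans (norm_eval_abs_le hμ hu)
  have h3 : (μ.eval (CFC.abs u)).re * m ≤ D / r * η := by
    calc (μ.eval (CFC.abs u)).re * m ≤ D * m := by gcongr
      _ = D / r * (r * m) := by field_simp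
      _ ≤ D / r * η := by gcongr
  have h4 : (1 + D / r) * η = ε := by rw [hη]; field_simp
  linarith

/-- `(1 - e) u` vanishes on `pointSet K`, so only the outer part of `ψ` sees it, and it is dominated
by `|u|`. This is why the integral of `|u|`, not of `u`, had to be bounded. -/
lemma norm_eval_sub_eval_mul_le {ψ : StateSpace C₀(X, ℂ)} {u : UA C₀(X, ℂ)}
    (hu : IsSelfAdjoint u) {ε : ℝ}
    (hε : (vectorFunctional (outerVector K ψ) (CFC.abs u)).re ≤ ε) {f : X → ℝ} {e : C₀(X, ℂ)}
    (he : ∀ x, e x = (f x : ℂ)) (h0 : ∀ x, 0 ≤ f x) (h1 : ∀ x, f x ≤ 1)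
    (hK : ∀ x ∈ pointSet K, f x = 1) :
    ‖ψ.eval u - ψ.eval (incl e * u)‖ ≤ ε := by
  have hev (x : X) : ev x (u - incl e * u) = (((1 - f x) * (ev x u).re : ℝ) : ℂ) := by
    rw [map_sub, map_mul, ev_incl, he, Complex.ofReal_mul, isSelfAdjoint_iff_ev.1 hu]
    push_cast
    ring
  rw [← StateSpace.eval_sub, eval_eq_vectorFunctional_outerVector (K := K)]
  · refine (norm_vectorFunctional_le _ (isSelfAdjoint_iff_ev.2 fun x => ?_) (isSelfAdjoint_abs u)
      fun x => ?_).trans hε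
    · rw [hev, Complex.ofReal_re]
    · rw [hev, Complex.norm_real, ev_abs, Complex.ofReal_re, Real.norm_eq_abs, abs_mul,
        abs_of_nonneg (sub_nonneg.2 (h1 x))]
      exact (mul_le_of_le_one_left (abs_nonneg _) (by linarith [h0 x])).trans
        (Complex.abs_re_le_norm _)
  · intro x hx
    rw [hev, hK x hx, sub_self, zero_mul, Complex.ofReal_zero]

lemma exists_incl_mul_eq (e : C₀(X, ℂ)) (u : UA C₀(X, ℂ)) :
    ∃ b : C₀(X, ℂ), incl e * u = incl b := by
  obtain ⟨a, c, rfl⟩ := u.exists_eq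
  refine ⟨e * a + c • e, ext_ev fun x => ?_⟩
  rw [map_mul, map_add, ev_incl, ev_incl, ev_incl, ev_algebraMap]
  simp [mul_add, mul_comm]

lemma norm_eval_mul_sub_le (ψ : StateSpace C₀(X, ℂ)) {u w : UA C₀(X, ℂ)}
    (hu : IsSelfAdjoint u) (hw : IsSelfAdjoint w) {f : X → ℝ} {e : C₀(X, ℂ)}
    (he : ∀ x, e x = (f x : ℂ)) (h0 : ∀ x, 0 ≤ f x) (h1 : ∀ x, f x ≤ 1)
    {K₁ : Set X} (hK₁ : ∀ x ∉ K₁, f x = 0) {ε : ℝ} (hε : 0 ≤ ε)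
    (hle : ∀ x ∈ K₁, ‖ev x u - ev x w‖ ≤ ε) :
    ‖ψ.eval (incl e * u) - ψ.eval (incl e * w)‖ ≤ ε := by
  have hev (x : X) : ev x (incl e * u - incl e * w) = ((f x * (ev x (u - w)).re : ℝ) : ℂ) := by
    rw [Complex.ofReal_mul, isSelfAdjoint_iff_ev.1 (hu.sub hw), map_sub, map_mul, map_mul, ev_incl,
      he, map_sub, mul_sub]
  have h := norm_vectorFunctional_le (stateVector ψ) (w := ε • 1)
    (isSelfAdjoint_iff_ev.2 fun x => by rw [hev, Complex.ofReal_re])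
    ((IsSelfAdjoint.all ε).smul (.one _)) fun x => by
      rw [hev, ev_real_smul, map_one, mul_one, Complex.ofReal_re, Complex.norm_real,
        Real.norm_eq_abs, abs_mul, abs_of_nonneg (h0 x)]
      by_cases hx : x ∈ K₁
      · have h2 : |(ev x (u - w)).re| ≤ ε := (Complex.abs_re_le_norm _).trans (by
          rw [map_sub]
          exact hle x hx)
        calc f x * |(ev x (u - w)).re| ≤ 1 * ε := mul_le_mul (h1 x) h2 (abs_nonneg _) zero_le_one
          _ = ε := one_mul ε
      · rw [hK₁ x hx, zero_mul]
        exact hε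
  rwa [vectorFunctional_stateVector, vectorFunctional_stateVector, StateSpace.eval_real_smul,
    StateSpace.eval_one, mul_one, Complex.ofReal_re, StateSpace.eval_sub] at h

/-- For each of the two states, passing from `u` to `e u` costs `ε` and from `e u` to `e w` costs `3
ε`; comparing the states at `e w` costs one more `ε`, whence `9 ε`. -/
lemma exists_finite_forall_norm_eval_sub_le {𝒦 : Set (StateSpace C₀(X, ℂ))}
    (h𝒦 : IsTame (unitalExtension lipSeminorm) ⊤ 𝒦) {ε : ℝ} (hε : 0 < ε) :
    ∃ F : Set C₀(X, ℂ), F.Finite ∧ ∀ φ ∈ 𝒦, ∀ ψ ∈ 𝒦,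
      (∀ b ∈ F, ‖ψ.eval (incl b) - φ.eval (incl b)‖ ≤ ε) → ∀ a : C₀(X, ℂ), IsSelfAdjoint a →
        unitalExtension lipSeminorm (incl a) ≤ 1 →
          ‖ψ.eval (incl a) - φ.eval (incl a)‖ ≤ 9 * ε := by
  obtain ⟨μ, hμ, ht⟩ := h𝒦
  obtain ⟨Kμ, hμ⟩ := Set.mem_iUnion.1 hμ
  obtain ⟨K, hK⟩ := exists_vectorFunctional_outerVector_abs_le hμ ht hε
  obtain ⟨r, -, K₁, hK₁, f, e, hef, hf0, hf1, hfK, hfK₁, -⟩ :=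
    exists_lipschitz_bump (isCompact_pointSet K)
  obtain ⟨x₀, hx₀⟩ := pointSet_nonempty_of_mem_localStates hμ
  obtain ⟨F, hFS, hF, hnet⟩ := exists_finite_net_of_lipschitz
    (S := lipschitzBall (unitalExtension lipSeminorm) μ) (g := fun u x => ev x u)
    (fun u hu => (unitalExtension_le_one_iff hu.1).1 hu.2.1)
    (fun u hu => norm_ev_le_of_mem_lipschitzBall hμ hu hx₀) hK₁ hε
  -- The net elements `w` lie only in `𝔲A`, but `e w` lies in `C₀(X)` and is thus a legitimate weak*
  -- test element.
  choose b hb using exists_incl_mul_eq e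
  refine ⟨b '' F, hF.image b, fun φ hφ ψ hψ h a ha hL => ?_⟩
  have ha' := isSelfAdjoint_incl_iff.2 ha
  -- Subtracting the scalar `μ a` puts `a` into the Lipschitz ball without changing the difference
  -- of two states.
  set u := incl a - (μ.eval (incl a)).re • (1 : UA C₀(X, ℂ)) with hu
  have hus : IsSelfAdjoint u := isSelfAdjoint_sub_smul_one ha' _
  have huball : u ∈ lipschitzBall (unitalExtension lipSeminorm) μ := by
    refine ⟨hus, (unitalExtension_le_one_iff hus).2 fun x y => ?_, ?_⟩
    · rw [ev_sub_smul_one, ev_sub_smul_one, sub_sub_sub_cancel_right]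
      exact (unitalExtension_le_one_iff ha').1 hL x y
    · rw [StateSpace.eval_sub_smul_one, StateSpace.eval_re _ ha', sub_self]
  have heq : ψ.eval (incl a) - φ.eval (incl a) = ψ.eval u - φ.eval u := by
    rw [hu, StateSpace.eval_sub_smul_one, StateSpace.eval_sub_smul_one, sub_sub_sub_cancel_right]
  obtain ⟨w, hw, huw⟩ := hnet u huball
  have hws := (hFS hw).1
  have h1 {ω : StateSpace C₀(X, ℂ)} (hω : ω ∈ 𝒦) : dist (ω.eval u) (ω.eval (incl e * u)) ≤ ε :=
    (dist_eq_norm _ _).trans_le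
      (norm_eval_sub_eval_mul_le hus (hK ω hω u huball) hef hf0 hf1 hfK)
  have h2 (ω : StateSpace C₀(X, ℂ)) :
      dist (ω.eval (incl e * u)) (ω.eval (incl e * w)) ≤ 3 * ε :=
    (dist_eq_norm _ _).trans_le
      (norm_eval_mul_sub_le ω hus hws hef hf0 hf1 hfK₁ (by positivity) huw)
  have h3 : dist (ψ.eval (incl e * w)) (φ.eval (incl e * w)) ≤ ε := by
    rw [dist_eq_norm, hb]
    exact h _ ⟨w, hw, rfl⟩
  rw [heq, ← dist_eq_norm]
  have t1 := dist_triangle4 (ψ.eval u) (ψ.eval (incl e * u)) (φ.eval (incl e * u)) (φ.eval u)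
  have t2 := dist_triangle4 (ψ.eval (incl e * u)) (ψ.eval (incl e * w)) (φ.eval (incl e * w))
    (φ.eval (incl e * u))
  have h4 := h1 hψ
  have h5 := h1 hφ
  have h6 := h2 ψ
  have h7 := h2 φ
  rw [dist_comm] at h5 h7
  linarith

lemma induced_mongeKantorovich_eq {𝒦 : Set (StateSpace C₀(X, ℂ))}
    (h𝒦 : IsTame (unitalExtension lipSeminorm) ⊤ 𝒦) :
    TopologicalSpace.induced (Subtype.val : 𝒦 → StateSpace C₀(X, ℂ))
        (mongeKantorovich
          (unitalExtension (lipSeminorm (X := X)))).toUniformSpace.toTopologicalSpace =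
      TopologicalSpace.induced (Subtype.val : 𝒦 → StateSpace C₀(X, ℂ)) (weakStar C₀(X, ℂ)) := by
  refine le_antisymm (induced_mono mongeKantorovich_le_weakStar) ?_
  refine le_of_nhds_le_nhds fun φ => ?_
  rw [@nhds_induced _ _ (weakStar C₀(X, ℂ)), @nhds_induced _ _ (mongeKantorovich
    (unitalExtension (lipSeminorm (X := X)))).toUniformSpace.toTopologicalSpace]
  let _ := mongeKantorovich (unitalExtension (lipSeminorm (X := X)))
  refine (Metric.nhds_basis_closedEBall.comap _).ge_iff.2 fun δ hδ => ?_
  obtain ⟨ε, hε, hεδ⟩ : ∃ ε : ℝ, 0 < ε ∧ ENNReal.ofReal (9 * ε) ≤ δ := by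
    obtain ⟨c, hc, hcδ⟩ := ENNReal.lt_iff_exists_nnreal_btwn.1 hδ
    refine ⟨c / 9, by have : 0 < c := by exact_mod_cast hc
                      positivity, ?_⟩
    rw [mul_div_cancel₀ _ (by norm_num), ENNReal.ofReal_coe_nnreal]
    exact hcδ.le
  obtain ⟨F, hF, h⟩ := exists_finite_forall_norm_eval_sub_le h𝒦 hε
  have hU : ∀ᶠ ψ in @nhds _ (weakStar C₀(X, ℂ)) φ.1,
      ∀ b ∈ F, ‖ψ.eval (incl b) - φ.1.eval (incl b)‖ ≤ ε := by
    refine (Filter.eventually_all_finite hF).2 fun b _ => ?_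
    have ht := (@Continuous.tendsto _ _ (weakStar C₀(X, ℂ)) _ _ (continuous_weakStar_eval b) φ.1)
    filter_upwards [Metric.tendsto_nhds.1 ht ε hε] with ψ hψ
    rw [← dist_eq_norm]
    exact hψ.le
  filter_upwards [Filter.preimage_mem_comap hU] with ψ hψ
  refine le_trans (edist_mongeKantorovich_le_iff.2 fun a ha hL => ?_) hεδ
  rw [edist_dist, dist_eq_norm]
  exact ENNReal.ofReal_le_ofReal (h φ.1 φ.2 ψ.1 ψ.2 hψ a ha hL)

end Tame

end QMetric

end

theorem mainTheorem8 (X : Type*) [MetricSpace X] [LocallyCompactSpace X] :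
    QMetric.IsQuantumLocallyCompactMetricSpace
      (QMetric.unitalExtension (QMetric.lipSeminorm (X := X)))
      (⊤ : NonUnitalStarSubalgebra ℂ C₀(X, ℂ)) where
  isLipschitzPair := QMetric.isLipschitzPair_unitalExtension_lipSeminorm
  isTopography := QMetric.isTopography_top _root_.mul_comm
  regular _ := QMetric.ediam_localStates_lt_top
  topology_eq _ h := QMetric.induced_mongeKantorovich_eq h
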